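/- Let $\mathfrak A$ be a finite-dimensional real normed division algebra with unit (that is, $\mathbb R$, $\mathbb C$, the quaternions or the octonions), let $\beta=\dim_{\mathbb R}\mathfrak A$, and let $n\ge m\ge 1$ be integers; if $\mathfrak A$ is not associative (the octonions), assume $m\le 2$. Notation. $X^*$ is the conjugate transpose; $\operatorname{tr}$ is the real part of the trace. $\mathfrak P_m$ is the cone of positive definite Hermitian $m\times m$ matrices over $\mathfrak A$, and for $S\in\mathfrak P_m$, $|S|$ is its determinant (the product of its $m$ eigenvalues, equivalently the positive $\beta$-th root of the determinant of the real-linear map $v\mapsto Sv$ on $\mathfrak A^m$). $(dX)$ is Lebesgue measure on $\mathfrak A^{n\times m}$ and $(dS)$ is Lebesgue measure on Hermitian matrices, in the real diagonal entries and the entries below the diagonal. $S=u(S)^*u(S)$ is the Cholesky decomposition of $S\in\mathfrak P_m$, with $u(S)$ upper triangular with positive diagonal. For $\kappa=(k_1,\dots,k_m)\in\mathbb R^m$, $$q_\kappa(S)=|S_m|^{k_m}\prod_{i=1}^{m-1}|S_i|^{k_i-k_{i+1}},$$ where $S_i$ is the leading principal $i\times i$ submatrix of $S$, and $$\Gamma_m^\beta[a,\kappa]=\int_{\mathfrak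 P_m}e^{-\operatorname{tr}S}\,|S|^{a-(m-1)\beta/2-1}q_\kappa(S)\,(dS),\qquad \Gamma_m^\beta[a]=\Gamma_m^\beta[a,0].$$ Let $\nu,k\in\mathbb R$, $\rho>0$, $\tau=(t_1,\dots,t_m)\in\mathbb R^m$ and $\Sigma\in\mathfrak P_m$ satisfy $\nu\beta/2+k>0$ and $n\beta/2>(i-1)\beta/2-t_i$ for $i=1,\dots,m$. Let $R$ be a random $n\times m$ matrix over $\mathfrak A$ with the matrix multivariate Pearson type II-Riesz distribution with parameters $(\nu,k,\tau,\rho,0,I_n,\Sigma)$, that is, with density with respect to $(dX)$ $$\frac{\Gamma_m^\beta[n\beta/2]\,\Gamma_1^\beta\big[(\nu+mn)\beta/2+k+\sum_i t_i\big]\,\rho^{\beta mn/2+\sum_i t_i}}{\pi^{\beta mn/2}\,\Gamma_m^\beta[n\beta/2,\tau]\,\Gamma_1^\beta[\nu\beta/2+k]\,|\Sigma|^{n\beta/2}}\,\big(1-\rho\operatorname{tr}\Sigma^{-1}X^*X\big)^{\nu\beta/2+k-1}\,q_\tau\big(u(\Sigma)^{*-1}X^*X\,u(\Sigma)^{-1}\big)$$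 on $1-\rho\operatorname{tr}\Sigma^{-1}X^*X>0$, and density $0$ elsewhere. Then $B=R^*R$ has density with respect to $(dB)$ $$\frac{\Gamma_1^\beta\big[(\nu+mn)\beta/2+k+\sum_i t_i\big]\,\rho^{\beta mn/2+\sum_i t_i}}{\Gamma_m^\beta[n\beta/2,\tau]\,\Gamma_1^\beta[\nu\beta/2+k]\,|\Sigma|^{n\beta/2}\,q_\tau(\Sigma)}\,|B|^{(n-m+1)\beta/2-1}\,\big(1-\rho\operatorname{tr}\Sigma^{-1}B\big)^{\nu\beta/2+k-1}\,q_\tau(B)$$ on $\{B\in\mathfrak P_m:\ 1-\rho\operatorname{tr}\Sigma^{-1}B>0\}$, and density $0$ elsewhere (the nonstandardised matrix multivariate beta-Riesz type I distribution). -/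

import Mathlib

open MeasureTheory ProbabilityTheory
open scoped ENNReal

noncomputable section

/-- A real normed division algebra: a nonzero, unital, not necessarily commutative or associative
real algebra whose underlying space carries an inner product with `(xy, xy) = (x, x) (y, y)`.
(The absence of zero divisors follows from the last field.) The finite-dimensional ones are the
reals, the complex numbers, the quaternions and the octonions. -/
class RealNormedDivisionAlgebra (A : Type*) [NormedAddCommGroup A] [InnerProductSpace ℝ A]
    extends Mul A, One A where
  add_mul' : ∀ x y z : A, (x + y) * z = x * z + y * z
  mul_add' : ∀ x y z : A, x * (y + z) = x * y + x * z
  smul_mul' : ∀ (c : ℝ) (x y : A), (c • x) * y = c • (x * y)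
  mul_smul' : ∀ (c : ℝ) (x y : A), x * (c • y) = c • (x * y)
  one_mul' : ∀ x : A, 1 * x = x
  mul_one' : ∀ x : A, x * 1 = x
  one_ne_zero' : (1 : A) ≠ 0
  inner_mul_self' : ∀ x y : A, inner ℝ (x * y) (x * y) = inner ℝ x x * inner ℝ y y

namespace PearsonRiesz

/-- The Borel sigma-algebra of the space of `n × m` matrices. -/
instance instMeasurableSpaceMatrix {n m : ℕ} {A : Type*} [MeasurableSpace A] :
    MeasurableSpace (Matrix (Fin n) (Fin m) A) :=
  inferInstanceAs (MeasurableSpace (Fin n → Fin m → A))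

variable {A : Type*} [NormedAddCommGroup A] [InnerProductSpace ℝ A] [RealNormedDivisionAlgebra A]

/-- The real part of an element of the algebra (the unit `1` has norm one). -/
def re (x : A) : ℝ := inner ℝ (1 : A) x

/-- The conjugate `2 Re(x) - x` of an element of the algebra. -/
def conj (x : A) : A := (2 * re x) • (1 : A) - x

/-- The conjugate transpose `X^*`. -/
def adj {n m : ℕ} (X : Matrix (Fin n) (Fin m) A) : Matrix (Fin m) (Fin n) A :=
  Matrix.of fun i j => conj (X j i)

/-- The (real part of the) trace. For a product of two Hermitian matrices over a noncommutative
algebra, `tr` always means this real number. -/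
def reTr {m : ℕ} (S : Matrix (Fin m) (Fin m) A) : ℝ := re (∑ i, S i i)

/-- The real-linear map `v ↦ S v` on columns. -/
def mulVecR {m : ℕ} (S : Matrix (Fin m) (Fin m) A) : (Fin m → A) →ₗ[ℝ] (Fin m → A) where
  toFun v i := ∑ j, S i j * v j
  map_add' v w := by
    funext i
    simp [RealNormedDivisionAlgebra.mul_add', Finset.sum_add_distrib]
  map_smul' c v := by
    funext i
    simp [RealNormedDivisionAlgebra.mul_smul', Finset.smul_sum]

/-- The determinant of a positive definite Hermitian matrix `S`: the positive number whose
`β`-th power, `β = dim A`, is the determinant of the real-linear map `v ↦ S v`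
(each of the `m` eigenvalues of `S` occurs `β` times as an eigenvalue of that map, so this is the
product of the eigenvalues; it is the usual determinant over the reals and the complex numbers, and
the Moore determinant over the quaternions). -/
def hdet {m : ℕ} (S : Matrix (Fin m) (Fin m) A) : ℝ :=
  LinearMap.det (mulVecR S) ^ (1 / (Module.finrank ℝ A : ℝ))

/-- The cone of positive definite Hermitian `m × m` matrices. -/
def posDefCone (m : ℕ) (A : Type*) [NormedAddCommGroup A] [InnerProductSpace ℝ A]
    [RealNormedDivisionAlgebra A] : Set (Matrix (Fin m) (Fin m) A) :=
  {S | adj S = S ∧ ∀ v : Fin m → A, v ≠ 0 → 0 < ∑ i, (inner ℝ (v i) (mulVecR S v i) : ℝ)}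

/-- `U` is the Cholesky factor of `S`: upper triangular with positive (real) diagonal entries and
`S = U^* U`. -/
def IsCholesky {m : ℕ} (U S : Matrix (Fin m) (Fin m) A) : Prop :=
  (∀ i j, j < i → U i j = 0) ∧ (∀ i, ∃ r : ℝ, 0 < r ∧ U i i = r • (1 : A)) ∧ S = adj U * U

open Classical in
/-- The Cholesky factor `u(S)` of a positive definite matrix `S`. -/
def chol {m : ℕ} (S : Matrix (Fin m) (Fin m) A) : Matrix (Fin m) (Fin m) A :=
  if h : ∃ U, IsCholesky U S then h.choose else 0

open Classical in
/-- The two-sided inverse of a square matrix. -/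
def matInv {m : ℕ} (S : Matrix (Fin m) (Fin m) A) : Matrix (Fin m) (Fin m) A :=
  if h : ∃ T, S * T = 1 ∧ T * S = 1 then h.choose else 0

/-- The leading principal submatrix of size `i + 1`. -/
def leading {m : ℕ} (S : Matrix (Fin m) (Fin m) A) (i : Fin m) :
    Matrix (Fin (i + 1)) (Fin (i + 1)) A :=
  S.submatrix (Fin.castLE i.isLt) (Fin.castLE i.isLt)

/-- The highest weight vector
`q_τ(S) = |S_m| ^ t_m * ∏_{i = 1}^{m - 1} |S_i| ^ (t_i - t_{i + 1})`,
where `S_i` is the leading principal submatrix of size `i`. -/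
def highestWeight {m : ℕ} (τ : Fin m → ℝ) (S : Matrix (Fin m) (Fin m) A) : ℝ :=
  ∏ i : Fin m, hdet (leading S i) ^
    (τ i - if h : (i : ℕ) + 1 < m then τ ⟨(i : ℕ) + 1, h⟩ else 0)

/-- The Lebesgue measure on `n × m` matrices: the product of the Lebesgue measures of the entries
(normalised by an orthonormal basis of the algebra). -/
def matVolume (n m : ℕ) (A : Type*) [NormedAddCommGroup A] [InnerProductSpace ℝ A]
    [FiniteDimensional ℝ A] [MeasurableSpace A] [BorelSpace A] :
    Measure (Matrix (Fin n) (Fin m) A) :=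
  (Measure.pi fun _ => Measure.pi fun _ => volume : Measure (Fin n → Fin m → A))

/-- The Hermitian matrix with diagonal entries `d` and entries `l` below the diagonal. -/
def hermOf (m : ℕ) (A : Type*) [NormedAddCommGroup A] [InnerProductSpace ℝ A]
    [RealNormedDivisionAlgebra A]
    (c : (Fin m → ℝ) × ({p : Fin m × Fin m // p.2 < p.1} → A)) : Matrix (Fin m) (Fin m) A :=
  Matrix.of fun i j =>
    if h : j < i then c.2 ⟨(i, j), h⟩
    else if h : i < j then conj (c.2 ⟨(j, i), h⟩)
    else c.1 i • (1 : A)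

/-- The Lebesgue measure on Hermitian `m × m` matrices, as a measure on all `m × m` matrices that
is carried by the Hermitian ones: the product of the Lebesgue measures of the real diagonal entries
and of the entries below the diagonal. -/
def hermVolume (m : ℕ) (A : Type*) [NormedAddCommGroup A] [InnerProductSpace ℝ A]
    [RealNormedDivisionAlgebra A] [FiniteDimensional ℝ A] [MeasurableSpace A] [BorelSpace A] :
    Measure (Matrix (Fin m) (Fin m) A) :=
  ((Measure.pi fun _ : Fin m => (volume : Measure ℝ)).prod
    (Measure.pi fun _ : {p : Fin m × Fin m // p.2 < p.1} => (volume : Measure A))).map (hermOf m A)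

/-- The generalised gamma function of weight `κ`,
`Γ_m[a, κ] = ∫_{S > 0} exp(-tr S) |S| ^ (a - (m - 1) β / 2 - 1) q_κ(S) dS`. -/
def genGamma (m : ℕ) (A : Type*) [NormedAddCommGroup A] [InnerProductSpace ℝ A]
    [RealNormedDivisionAlgebra A] [FiniteDimensional ℝ A] [MeasurableSpace A] [BorelSpace A]
    (a : ℝ) (κ : Fin m → ℝ) : ℝ :=
  ∫ S in posDefCone m A,
    Real.exp (-reTr S) * hdet S ^ (a - ((m : ℝ) - 1) * (Module.finrank ℝ A : ℝ) / 2 - 1) *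
      highestWeight κ S ∂(hermVolume m A)

/-- The multivariate gamma function `Γ_m[a]`. -/
def mvGamma (m : ℕ) (A : Type*) [NormedAddCommGroup A] [InnerProductSpace ℝ A]
    [RealNormedDivisionAlgebra A] [FiniteDimensional ℝ A] [MeasurableSpace A] [BorelSpace A]
    (a : ℝ) : ℝ :=
  genGamma m A a 0

variable [FiniteDimensional ℝ A] [MeasurableSpace A] [BorelSpace A]

open Classical in
/-- The density, with respect to the Lebesgue measure on `n × m` matrices, of the matrix multivariate
Pearson type II-Riesz distribution with parameters `ν, k, τ, ρ`, location `0`, row scale `I_n` and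
column scale `Σ` (here `Sg`). -/
def pearsonDensity {n m : ℕ} (ν k : ℝ) (τ : Fin m → ℝ) (ρ : ℝ) (Sg : Matrix (Fin m) (Fin m) A)
    (X : Matrix (Fin n) (Fin m) A) : ℝ :=
  let β : ℝ := Module.finrank ℝ A
  if 0 < 1 - ρ * reTr (matInv Sg * (adj X * X)) then
    mvGamma m A (n * β / 2) * mvGamma 1 A ((ν + m * n) * β / 2 + k + ∑ i, τ i) *
        ρ ^ (m * n * β / 2 + ∑ i, τ i) /
      (Real.pi ^ (β * m * n / 2) * genGamma m A (n * β / 2) τ * mvGamma 1 A (ν * β / 2 + k) *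
        hdet Sg ^ (β * n / 2)) *
      (1 - ρ * reTr (matInv Sg * (adj X * X))) ^ (ν * β / 2 + k - 1) *
      highestWeight τ (matInv (adj (chol Sg)) * (adj X * X) * matInv (chol Sg))
  else 0

/-- The matrix multivariate Pearson type II-Riesz distribution (location `0`, row scale `I_n`). -/
def pearsonLaw (n : ℕ) {m : ℕ} (ν k : ℝ) (τ : Fin m → ℝ) (ρ : ℝ)
    (Sg : Matrix (Fin m) (Fin m) A) : Measure (Matrix (Fin n) (Fin m) A) :=
  (matVolume n m A).withDensity fun X => ENNReal.ofReal (pearsonDensity ν k τ ρ Sg X)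

open Classical in
/-- The density, with respect to the Lebesgue measure on Hermitian `m × m` matrices, of the
nonstandardised matrix multivariate beta-Riesz type I distribution. -/
def betaRieszDensity (n : ℕ) {m : ℕ} (ν k : ℝ) (τ : Fin m → ℝ) (ρ : ℝ)
    (Sg B : Matrix (Fin m) (Fin m) A) : ℝ :=
  let β : ℝ := Module.finrank ℝ A
  if B ∈ posDefCone m A ∧ 0 < 1 - ρ * reTr (matInv Sg * B) then
    mvGamma 1 A ((ν + m * n) * β / 2 + k + ∑ i, τ i) * ρ ^ (β * m * n / 2 + ∑ i, τ i) /
      (genGamma m A (n * β / 2) τ * mvGamma 1 A (ν * β / 2 + k) *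
        hdet Sg ^ (n * β / 2) * highestWeight τ Sg) *
      hdet B ^ (((n : ℝ) - m + 1) * β / 2 - 1) *
      (1 - ρ * reTr (matInv Sg * B)) ^ (ν * β / 2 + k - 1) *
      highestWeight τ B
  else 0

/-- The nonstandardised matrix multivariate beta-Riesz type I distribution. -/
def betaRieszLaw (n : ℕ) {m : ℕ} (ν k : ℝ) (τ : Fin m → ℝ) (ρ : ℝ)
    (Sg : Matrix (Fin m) (Fin m) A) : Measure (Matrix (Fin m) (Fin m) A) :=
  (hermVolume m A).withDensity fun B => ENNReal.ofReal (betaRieszDensity n ν k τ ρ Sg B)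

end PearsonRiesz

end

open PearsonRiesz

/-! The Pearson density depends on `X` only through the Gram matrix `X^* X`, so everything rests on
the image of Lebesgue measure under `X ↦ X^* X`. This image has density `C |S| ^ ((n - m + 1) β / 2
- 1)` on the cone for a finite nonzero constant `C` (`exists_gramDensity`). No Stiefel manifold is
used: the proof is an induction on the number of columns. Appending a column `x` to `X` borders `S =
X^* X` by the column `y = X^* x` and the corner `r = ‖x‖²`. For fixed `X`, the law of `(y, r)` comes
from splitting `x` along the kernel of `X^*` and its orthogonal complement
(`exists_lintegral_fibre`). The Jacobian is `|S| ^ (-β / 2)`, and the kernel part contributes a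
power of the Schur complement `r - y^* S⁻¹ y`, which is the ratio of the bordered determinant to
`|S|`. The powers of `|S|` then cancel (`colKernel_mul_eq`).

The constant is found at the end by integrating `exp (-tr X^* X)` in two ways, which gives `C
Γ_m[nβ/2] = π ^ (βmn/2)` (`GramDensity.mul_mvGamma`). This removes the factor `Γ_m[nβ/2] / π ^
(βmn/2)` of the Pearson density. The other gamma factors occur identically on both sides and are
never evaluated. The last ingredient is `q_τ(u(Σ)^{*-1} B u(Σ)^{-1}) = q_τ(B) / q_τ(Σ)`
(`highestWeight_conj_chol`), true because triangular factors respect leading blocks.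

Octonions need no separate theory. When `m ≤ 2`, the block being bordered has size at most one,
hence only real entries, and the identity `x̄ (x y) = ‖x‖² y` replaces associativity. The hypothesis
"associative or `m ≤ 1`" on the bordered block expresses this. Only the inverse of a triangular
matrix and the determinant of `V^* B V` are checked by hand in size two. -/

namespace PearsonRiesz

/-! ### Composition algebra identities, without associativity -/

section Algebra

variable {A : Type*} [NormedAddCommGroup A] [InnerProductSpace ℝ A] [RealNormedDivisionAlgebra A]

open RealNormedDivisionAlgebra

theorem zero_mul_alg (x : A) : 0 * x = 0 := by
  have := smul_mul' (0 : ℝ) (0 : A) x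
  simpa using this

theorem mul_zero_alg (x : A) : x * 0 = 0 := by
  have := mul_smul' (0 : ℝ) x (0 : A)
  simpa using this

theorem sub_mul_alg (x y z : A) : (x - y) * z = x * z - y * z := by
  rw [eq_sub_iff_add_eq, ← add_mul', sub_add_cancel]

theorem mul_sub_alg (x y z : A) : x * (y - z) = x * y - x * z := by
  rw [eq_sub_iff_add_eq, ← mul_add', sub_add_cancel]

theorem mul_neg_alg (x y : A) : x * (-y) = -(x * y) := by
  rw [← zero_sub, mul_sub_alg, mul_zero_alg, zero_sub]

theorem mul_sum_alg {ι : Type*} (s : Finset ι) (x : A) (f : ι → A) :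
    x * ∑ i ∈ s, f i = ∑ i ∈ s, x * f i := by
  classical
  induction s using Finset.induction_on with
  | empty => simp [mul_zero_alg]
  | insert a s ha ih => rw [Finset.sum_insert ha, Finset.sum_insert ha, mul_add', ih]

theorem sum_mul_alg {ι : Type*} (s : Finset ι) (x : A) (f : ι → A) :
    (∑ i ∈ s, f i) * x = ∑ i ∈ s, f i * x := by
  classical
  induction s using Finset.induction_on with
  | empty => simp [zero_mul_alg]
  | insert a s ha ih => rw [Finset.sum_insert ha, Finset.sum_insert ha, add_mul', ih]

theorem norm_mul_alg (x y : A) : ‖x * y‖ = ‖x‖ * ‖y‖ := by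
  have h := inner_mul_self' x y
  simp only [real_inner_self_eq_norm_sq] at h
  rw [← mul_pow] at h
  exact (pow_left_inj₀ (norm_nonneg _) (by positivity) two_ne_zero).1 h

theorem norm_one_alg : ‖(1 : A)‖ = 1 := by
  have h := norm_mul_alg (1 : A) 1
  rw [one_mul'] at h
  have h0 : ‖(1 : A)‖ ≠ 0 := norm_ne_zero_iff.2 one_ne_zero'
  field_simp at h
  exact h.symm

theorem inner_one_one : inner ℝ (1 : A) 1 = (1 : ℝ) := by
  rw [real_inner_self_eq_norm_sq, norm_one_alg]; norm_num

theorem inner_mul_left_alg (x y z : A) : inner ℝ (x * y) (x * z) = ‖x‖ ^ 2 * inner ℝ y z := by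
  have h := inner_mul_self' x (y + z)
  have hy := inner_mul_self' x y
  have hz := inner_mul_self' x z
  simp only [mul_add', inner_add_left, inner_add_right] at h
  rw [real_inner_comm (x * y) (x * z), real_inner_comm y z] at h
  rw [real_inner_self_eq_norm_sq x] at *
  linarith

theorem inner_mul_right_alg (x y z : A) : inner ℝ (x * z) (y * z) = inner ℝ x y * ‖z‖ ^ 2 := by
  have h := inner_mul_self' (x + y) z
  have hy := inner_mul_self' x z
  have hz := inner_mul_self' y z
  simp only [add_mul', inner_add_left, inner_add_right] at h
  rw [real_inner_comm (x * z) (y * z), real_inner_comm x y] at h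
  rw [real_inner_self_eq_norm_sq z] at *
  linarith

/-- Full polarisation of `|xy|² = |x|² |y|²` in both factors. Setting one variable to `1` yields the
adjointness of multiplication by `x` and by its conjugate, from which the other conjugation rules
follow. -/
theorem inner_mul_mul_add (x y z w : A) :
    inner ℝ (x * y) (z * w) + inner ℝ (x * w) (z * y) = (2 * (inner ℝ x z * inner ℝ y w) : ℝ) := by
  have h := inner_mul_right_alg x z (y + w)
  have hy := inner_mul_right_alg x z y
  have hw := inner_mul_right_alg x z w
  rw [norm_add_sq_real] at h
  simp only [mul_add', inner_add_left, inner_add_right] at h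
  linarith

theorem re_add (x y : A) : re (x + y) = re x + re y := inner_add_right _ _ _

theorem re_sub (x y : A) : re (x - y) = re x - re y := inner_sub_right _ _ _

theorem re_smul (c : ℝ) (x : A) : re (c • x) = c * re x := real_inner_smul_right _ _ _

theorem re_one : re (1 : A) = 1 := inner_one_one

theorem re_sum {ι : Type*} (s : Finset ι) (f : ι → A) : re (∑ i ∈ s, f i) = ∑ i ∈ s, re (f i) :=
  inner_sum _ _ _

theorem re_conj (x : A) : re (conj x) = re x := by
  rw [conj, re_sub, re_smul, re_one]; ring

theorem conj_conj (x : A) : conj (conj x) = x := by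
  rw [conj, re_conj, conj]; abel

theorem conj_add (x y : A) : conj (x + y) = conj x + conj y := by
  simp only [conj, re_add]
  module

theorem conj_smul (c : ℝ) (x : A) : conj (c • x) = c • conj x := by
  simp only [conj, re_smul]
  module

theorem conj_zero : conj (0 : A) = 0 := by
  simpa using conj_smul (0 : ℝ) (0 : A)

theorem conj_one : conj (1 : A) = 1 := by
  rw [conj, re_one]; module

theorem conj_smul_one (r : ℝ) : conj (r • (1 : A)) = r • (1 : A) := by
  rw [conj_smul, conj_one]

/-- Conjugation as a linear map. -/
def conjL (A : Type*) [NormedAddCommGroup A] [InnerProductSpace ℝ A]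
    [RealNormedDivisionAlgebra A] : A →ₗ[ℝ] A where
  toFun := conj
  map_add' := conj_add
  map_smul' := conj_smul

theorem conj_sum {ι : Type*} (s : Finset ι) (f : ι → A) :
    conj (∑ i ∈ s, f i) = ∑ i ∈ s, conj (f i) := map_sum (conjL A) f s

theorem norm_conj (x : A) : ‖conj x‖ = ‖x‖ := by
  have h : ‖conj x‖ ^ 2 = ‖x‖ ^ 2 := by
    rw [← real_inner_self_eq_norm_sq, conj]
    simp only [inner_sub_left, inner_sub_right, real_inner_smul_left, real_inner_smul_right,
      inner_one_one, real_inner_comm (1 : A) x, re]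
    rw [real_inner_self_eq_norm_sq]
    ring
  exact (pow_left_inj₀ (norm_nonneg _) (by positivity) two_ne_zero).1 h

/-- Conjugation as a linear isometry. -/
def conjE (A : Type*) [NormedAddCommGroup A] [InnerProductSpace ℝ A]
    [RealNormedDivisionAlgebra A] : A ≃ₗᵢ[ℝ] A where
  toLinearEquiv := LinearEquiv.ofInvolutive (conjL A) conj_conj
  norm_map' := norm_conj

theorem inner_conj_conj (x y : A) : inner ℝ (conj x) (conj y) = (inner ℝ x y : ℝ) :=
  (conjE A).inner_map_map x y

theorem inner_conj_mul (x y z : A) : inner ℝ (conj x * y) z = (inner ℝ y (x * z) : ℝ) := by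
  have h := inner_mul_mul_add x y 1 z
  rw [one_mul', one_mul'] at h
  rw [conj, sub_mul_alg, RealNormedDivisionAlgebra.smul_mul', one_mul', inner_sub_left, real_inner_smul_left, re,
    real_inner_comm x 1, real_inner_comm (x * z) y]
  linarith

theorem inner_mul_conj (x y z : A) : inner ℝ (y * conj x) z = (inner ℝ y (z * x) : ℝ) := by
  have h := inner_mul_mul_add y x z 1
  rw [mul_one', mul_one'] at h
  rw [conj, mul_sub_alg, mul_smul', mul_one', inner_sub_left, real_inner_smul_left, re,
    real_inner_comm x 1]
  linarith

/-- Left multiplication by `conj x` is the adjoint of left multiplication by `x`, which scales inner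
products by `‖x‖²`. This is the fragment of associativity that is available over the octonions. -/
theorem conj_mul_mul (x y : A) : conj x * (x * y) = ‖x‖ ^ 2 • y := by
  refine ext_inner_right ℝ fun z => ?_
  rw [inner_conj_mul, inner_mul_left_alg, real_inner_smul_left]

theorem conj_mul_self (x : A) : conj x * x = ‖x‖ ^ 2 • (1 : A) := by
  simpa [mul_one'] using conj_mul_mul x 1

theorem re_mul_eq (x y : A) : re (x * y) = inner ℝ (conj x) y := by
  rw [re, ← inner_conj_mul, mul_one']

theorem re_conj_mul (x y : A) : re (conj x * y) = inner ℝ x y := by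
  rw [re_mul_eq, conj_conj]

theorem conj_mul (x y : A) : conj (x * y) = conj y * conj x := by
  refine ext_inner_right ℝ fun z => ?_
  rw [inner_conj_mul, ← inner_mul_conj, inner_conj_mul, ← inner_conj_conj (conj (x * y)) z,
    conj_conj, real_inner_comm]

theorem eq_re_smul_of_conj {x : A} (h : conj x = x) : x = re x • (1 : A) := by
  rw [conj, sub_eq_iff_eq_add] at h
  have : (2 : ℝ) • x = (2 : ℝ) • (re x • (1 : A)) := by
    rw [smul_smul, h]; module
  exact smul_right_injective A (two_ne_zero (α := ℝ)) this

theorem add_conj (x : A) : x + conj x = (2 * re x) • (1 : A) := by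
  rw [conj]; abel

theorem finrank_pos_alg [FiniteDimensional ℝ A] : 0 < Module.finrank ℝ A := by
  have : Nontrivial A := ⟨1, 0, one_ne_zero'⟩
  exact Module.finrank_pos

end Algebra

/-! ### Determinants of block triangular linear maps -/

section BlockDet

variable {V W : Type*} [AddCommGroup V] [Module ℝ V] [FiniteDimensional ℝ V]
  [AddCommGroup W] [Module ℝ W] [FiniteDimensional ℝ W]

open LinearMap in
theorem det_prod_lower (f : V →ₗ[ℝ] V) (h : V →ₗ[ℝ] W) (g : W →ₗ[ℝ] W) :
    LinearMap.det ((f ∘ₗ fst ℝ V W).prod (h ∘ₗ fst ℝ V W + g ∘ₗ snd ℝ V W)) =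
      LinearMap.det f * LinearMap.det g := by
  let b := Module.finBasis ℝ V
  let b' := Module.finBasis ℝ W
  have key : LinearMap.toMatrix (b.prod b') (b.prod b')
      ((f ∘ₗ fst ℝ V W).prod (h ∘ₗ fst ℝ V W + g ∘ₗ snd ℝ V W)) =
      Matrix.fromBlocks (LinearMap.toMatrix b b f) 0 (LinearMap.toMatrix b b' h)
        (LinearMap.toMatrix b' b' g) := by
    ext (i | i) (j | j) <;> simp [LinearMap.toMatrix_apply]
  rw [← LinearMap.det_toMatrix (b.prod b'), key, Matrix.det_fromBlocks_zero₁₂,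
    LinearMap.det_toMatrix, LinearMap.det_toMatrix]

open LinearMap in
theorem det_prod_upper (f : V →ₗ[ℝ] V) (h : W →ₗ[ℝ] V) (g : W →ₗ[ℝ] W) :
    LinearMap.det ((f ∘ₗ fst ℝ V W + h ∘ₗ snd ℝ V W).prod (g ∘ₗ snd ℝ V W)) =
      LinearMap.det f * LinearMap.det g := by
  let b := Module.finBasis ℝ V
  let b' := Module.finBasis ℝ W
  have key : LinearMap.toMatrix (b.prod b') (b.prod b')
      ((f ∘ₗ fst ℝ V W + h ∘ₗ snd ℝ V W).prod (g ∘ₗ snd ℝ V W)) =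
      Matrix.fromBlocks (LinearMap.toMatrix b b f) (LinearMap.toMatrix b' b h) 0
        (LinearMap.toMatrix b' b' g) := by
    ext (i | i) (j | j) <;> simp [LinearMap.toMatrix_apply]
  rw [← LinearMap.det_toMatrix (b.prod b'), key, Matrix.det_fromBlocks_zero₂₁,
    LinearMap.det_toMatrix, LinearMap.det_toMatrix]

end BlockDet

/-! ### The real inner product on columns -/

section ColumnInner

variable {A : Type*} [NormedAddCommGroup A] [InnerProductSpace ℝ A]

/-- The real inner product of columns. -/
def dotR {m : ℕ} (v w : Fin m → A) : ℝ := ∑ i, inner ℝ (v i) (w i)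

theorem dotR_comm {m : ℕ} (v w : Fin m → A) : dotR v w = dotR w v :=
  Finset.sum_congr rfl fun _ _ => real_inner_comm _ _

theorem dotR_add_right {m : ℕ} (u v w : Fin m → A) : dotR u (v + w) = dotR u v + dotR u w := by
  simp [dotR, inner_add_right, Finset.sum_add_distrib]

theorem dotR_add_left {m : ℕ} (u v w : Fin m → A) : dotR (u + v) w = dotR u w + dotR v w := by
  simp [dotR, inner_add_left, Finset.sum_add_distrib]

end ColumnInner

/-! ### Bordered Hermitian matrices and Schur complements -/

section Matrices

variable {A : Type*} [NormedAddCommGroup A] [InnerProductSpace ℝ A] [RealNormedDivisionAlgebra A]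

open RealNormedDivisionAlgebra

/-- The real-linear map `v ↦ X v` of a rectangular matrix. -/
def actL {n m : ℕ} (X : Matrix (Fin n) (Fin m) A) : (Fin m → A) →ₗ[ℝ] (Fin n → A) where
  toFun v i := ∑ j, X i j * v j
  map_add' v w := by
    funext i
    simp [mul_add', Finset.sum_add_distrib]
  map_smul' c v := by
    funext i
    simp [mul_smul', Finset.smul_sum]

theorem actL_apply {n m : ℕ} (X : Matrix (Fin n) (Fin m) A) (v : Fin m → A) (i : Fin n) :
    actL X v i = ∑ j, X i j * v j := rfl

theorem mulVecR_apply {m : ℕ} (S : Matrix (Fin m) (Fin m) A) (v : Fin m → A) (i : Fin m) :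
    mulVecR S v i = ∑ j, S i j * v j := rfl

theorem adj_apply {n m : ℕ} (X : Matrix (Fin n) (Fin m) A) (i : Fin m) (j : Fin n) :
    adj X i j = conj (X j i) := rfl

theorem adj_adj {n m : ℕ} (X : Matrix (Fin n) (Fin m) A) : adj (adj X) = X := by
  ext i j
  simp [adj_apply, conj_conj]

theorem adj_mul {n m l : ℕ} (X : Matrix (Fin n) (Fin m) A) (Y : Matrix (Fin m) (Fin l) A) :
    adj (X * Y) = adj Y * adj X := by
  ext i j
  simp [adj_apply, Matrix.mul_apply, conj_sum, conj_mul]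

theorem dotR_actL_adj {n m : ℕ} (X : Matrix (Fin n) (Fin m) A) (x : Fin n → A) (v : Fin m → A) :
    dotR (actL (adj X) x) v = dotR x (actL X v) := by
  simp only [dotR, actL_apply, sum_inner, inner_sum, adj_apply, inner_conj_mul]
  exact Finset.sum_comm

theorem dotR_mulVecR {m : ℕ} {S : Matrix (Fin m) (Fin m) A} (hS : adj S = S) (v w : Fin m → A) :
    dotR (mulVecR S v) w = dotR v (mulVecR S w) := by
  conv_lhs => rw [← hS]
  exact dotR_actL_adj S v w

theorem mem_posDefCone_iff {m : ℕ} {S : Matrix (Fin m) (Fin m) A} :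
    S ∈ posDefCone m A ↔ adj S = S ∧ ∀ v, v ≠ 0 → 0 < dotR v (mulVecR S v) := Iff.rfl

theorem dotR_mulVecR_nonneg {m : ℕ} {S : Matrix (Fin m) (Fin m) A} (hS : S ∈ posDefCone m A)
    (v : Fin m → A) : 0 ≤ dotR v (mulVecR S v) := by
  by_cases hv : v = 0
  · simp [hv, dotR]
  · exact (hS.2 v hv).le

theorem mulVecR_injective {m : ℕ} {S : Matrix (Fin m) (Fin m) A} (hS : S ∈ posDefCone m A) :
    Function.Injective (mulVecR S) := by
  refine (injective_iff_map_eq_zero _).2 fun v hv => ?_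
  by_contra h
  have := (mem_posDefCone_iff.1 hS).2 v h
  simp [hv, dotR] at this

theorem diag_eq_of_adj {m : ℕ} {S : Matrix (Fin m) (Fin m) A} (hS : adj S = S) (i : Fin m) :
    S i i = re (S i i) • (1 : A) :=
  eq_re_smul_of_conj (congrFun (congrFun hS i) i)

/-- With a single column the only products that occur are `conj x * (x * v)`, so `conj_mul_mul` does
the work of associativity. -/
theorem actL_adj_actL {n m : ℕ} (h : (∀ x y z : A, x * y * z = x * (y * z)) ∨ m ≤ 1)
    (X : Matrix (Fin n) (Fin m) A) (v : Fin m → A) :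
    actL (adj X) (actL X v) = mulVecR (adj X * X) v := by
  have key : ∀ (k : Fin n) (i j : Fin m),
      conj (X k i) * X k j * v j = conj (X k i) * (X k j * v j) := by
    intro k i j
    rcases h with h | h
    · exact h _ _ _
    · obtain rfl : i = j := by apply Fin.ext; omega
      rw [conj_mul_mul, conj_mul_self, RealNormedDivisionAlgebra.smul_mul', one_mul']
  funext i
  simp only [actL_apply, mulVecR_apply, Matrix.mul_apply, adj_apply, mul_sum_alg, sum_mul_alg, key]
  exact Finset.sum_comm

theorem mulVecR_mul_right {m : ℕ} (h : (∀ x y z : A, x * y * z = x * (y * z)) ∨ m ≤ 1)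
    {S : Matrix (Fin m) (Fin m) A} (hS : adj S = S) (w : Fin m → A) (a : A) :
    mulVecR S (fun j => w j * a) = fun i => mulVecR S w i * a := by
  funext i
  simp only [mulVecR_apply, sum_mul_alg]
  refine Finset.sum_congr rfl fun j _ => ?_
  rcases h with h | h
  · rw [h]
  · obtain rfl : i = j := by apply Fin.ext; omega
    rw [diag_eq_of_adj hS i]
    simp only [RealNormedDivisionAlgebra.smul_mul', one_mul']

/-- The quantity `w^* S w` is self-conjugate, hence a real scalar; it is the number subtracted in
the Schur complement. -/
theorem sum_conj_mulVecR_mul {m : ℕ} (h : (∀ x y z : A, x * y * z = x * (y * z)) ∨ m ≤ 1)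
    {S : Matrix (Fin m) (Fin m) A} (hS : adj S = S) (w : Fin m → A) (a : A) :
    ∑ j, conj (mulVecR S w j) * (w j * a) = dotR (mulVecR S w) w • a := by
  rcases h with h | h
  · simp only [← h, ← sum_mul_alg]
    have hq : conj (∑ j, conj (mulVecR S w j) * w j) = ∑ j, conj (mulVecR S w j) * w j := by
      simp only [mulVecR_apply, conj_sum, conj_mul, conj_conj, sum_mul_alg]
      rw [Finset.sum_comm]
      refine Finset.sum_congr rfl fun j _ => Finset.sum_congr rfl fun k _ => ?_
      conv_lhs => rw [← hS]
      rw [adj_apply, h]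
    rw [eq_re_smul_of_conj hq, re_sum, RealNormedDivisionAlgebra.smul_mul', one_mul']
    simp only [re_conj_mul, dotR]
  · rw [dotR, Finset.sum_smul]
    refine Finset.sum_congr rfl fun j _ => ?_
    have : mulVecR S w j = re (S j j) • w j := by
      rw [mulVecR_apply, Finset.sum_eq_single j, diag_eq_of_adj hS j,
        RealNormedDivisionAlgebra.smul_mul', one_mul', re_smul, re_one, mul_one]
      · intro k _ hk
        exact absurd (by apply Fin.ext; omega) hk
      · simp
    rw [this, conj_smul, RealNormedDivisionAlgebra.smul_mul', conj_mul_mul, real_inner_smul_left,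
      real_inner_self_eq_norm_sq, smul_smul]

/-- The Hermitian matrix with leading block `S`, last column `y` and corner entry `r`. -/
def asm {m : ℕ} (S : Matrix (Fin m) (Fin m) A) (y : Fin m → A) (r : ℝ) :
    Matrix (Fin (m + 1)) (Fin (m + 1)) A :=
  Matrix.of fun i j =>
    Fin.lastCases (Fin.lastCases (r • (1 : A)) (fun j => conj (y j)) j)
      (fun i => Fin.lastCases (y i) (fun j => S i j) j) i

section Asm

variable {m : ℕ} (S : Matrix (Fin m) (Fin m) A) (y : Fin m → A) (r : ℝ)

@[simp] theorem asm_castSucc_castSucc (i j : Fin m) :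
    asm S y r i.castSucc j.castSucc = S i j := by simp [asm]

@[simp] theorem asm_castSucc_last (i : Fin m) : asm S y r i.castSucc (Fin.last m) = y i := by
  simp [asm]

@[simp] theorem asm_last_castSucc (j : Fin m) :
    asm S y r (Fin.last m) j.castSucc = conj (y j) := by simp [asm]

@[simp] theorem asm_last_last : asm S y r (Fin.last m) (Fin.last m) = r • (1 : A) := by simp [asm]

theorem adj_asm : adj (asm S y r) = asm (adj S) y r := by
  ext i j
  refine Fin.lastCases ?_ (fun i => ?_) i <;> refine Fin.lastCases ?_ (fun j => ?_) j <;>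
    simp [adj_apply, conj_conj, conj_smul_one]

theorem eq_asm_of_adj {T : Matrix (Fin (m + 1)) (Fin (m + 1)) A} (hT : adj T = T) :
    T = asm (T.submatrix Fin.castSucc Fin.castSucc) (fun i => T i.castSucc (Fin.last m))
      (re (T (Fin.last m) (Fin.last m))) := by
  ext i j
  refine Fin.lastCases ?_ (fun i => ?_) i <;> refine Fin.lastCases ?_ (fun j => ?_) j
  · rw [asm_last_last, ← diag_eq_of_adj hT]
  · rw [asm_last_castSucc, ← adj_apply, hT]
  · simp
  · simp

theorem asm_inj {S' : Matrix (Fin m) (Fin m) A} {y' : Fin m → A} {r' : ℝ} :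
    asm S y r = asm S' y' r' ↔ S = S' ∧ y = y' ∧ r = r' := by
  refine ⟨fun h => ⟨?_, ?_, ?_⟩, fun ⟨h1, h2, h3⟩ => by rw [h1, h2, h3]⟩
  · ext i j
    simpa using congrFun (congrFun h i.castSucc) j.castSucc
  · ext i
    simpa using congrFun (congrFun h i.castSucc) (Fin.last m)
  · have := congrArg re (congrFun (congrFun h (Fin.last m)) (Fin.last m))
    simpa [re_smul, re_one] using this

theorem dotR_asm (v : Fin (m + 1) → A) :
    dotR v (mulVecR (asm S y r) v) =
      dotR (fun i => v i.castSucc) (mulVecR S fun i => v i.castSucc) +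
      2 * dotR (fun i => v i.castSucc) (fun i => y i * v (Fin.last m)) +
      r * ‖v (Fin.last m)‖ ^ 2 := by
  simp only [dotR, mulVecR_apply, Fin.sum_univ_castSucc, asm_castSucc_castSucc, asm_castSucc_last,
    asm_last_castSucc, asm_last_last, RealNormedDivisionAlgebra.smul_mul', one_mul',
    inner_add_right, real_inner_smul_right, inner_sum, Finset.sum_add_distrib,
    real_inner_self_eq_norm_sq]
  have : ∀ j : Fin m, (inner ℝ (v (Fin.last m)) (conj (y j) * v j.castSucc) : ℝ) =
      inner ℝ (v j.castSucc) (y j * v (Fin.last m)) := fun j => by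
    rw [real_inner_comm, inner_conj_mul]
  simp only [this]
  ring

theorem mem_posDefCone_of_asm (h : asm S y r ∈ posDefCone (m + 1) A) : S ∈ posDefCone m A := by
  rw [mem_posDefCone_iff, adj_asm, asm_inj] at h
  refine ⟨h.1.1, fun v hv => ?_⟩
  have := h.2 (Fin.snoc (α := fun _ => A) v 0) fun h0 => hv <| by
    ext i
    simpa using congrFun h0 i.castSucc
  rw [dotR_asm] at this
  simpa [mul_zero_alg, dotR] using this

variable {S}

/-- Completing the square. Writing the last column as `S w` avoids `S⁻¹`: the Schur complement
becomes `r - ⟨S w, w⟩`. -/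
theorem dotR_asm_eq (h : (∀ x y z : A, x * y * z = x * (y * z)) ∨ m ≤ 1) (hS : adj S = S)
    (w : Fin m → A) (v : Fin (m + 1) → A) :
    dotR v (mulVecR (asm S (mulVecR S w) r) v) =
      dotR (fun i => v i.castSucc + w i * v (Fin.last m))
        (mulVecR S fun i => v i.castSucc + w i * v (Fin.last m)) +
      (r - dotR (mulVecR S w) w) * ‖v (Fin.last m)‖ ^ 2 := by
  rw [dotR_asm]
  set a := v (Fin.last m)
  have h1 : (fun i => v i.castSucc + w i * a) = (fun i => v i.castSucc) + fun i => w i * a := rfl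
  rw [h1, map_add, dotR_add_left, dotR_add_right, dotR_add_right, ← dotR_mulVecR hS (fun i => w i * a),
    mulVecR_mul_right h hS, dotR_comm (fun i => mulVecR S w i * a) (fun i => v i.castSucc)]
  have h2 : dotR (fun i => w i * a) (fun i => mulVecR S w i * a) =
      dotR (mulVecR S w) w * ‖a‖ ^ 2 := by
    simp only [dotR, inner_mul_right_alg, ← Finset.sum_mul]
    congr 1
    exact dotR_comm _ _
  rw [h2]
  ring

theorem asm_mem_posDefCone_iff (h : (∀ x y z : A, x * y * z = x * (y * z)) ∨ m ≤ 1)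
    (hS : S ∈ posDefCone m A) (w : Fin m → A) :
    asm S (mulVecR S w) r ∈ posDefCone (m + 1) A ↔ dotR (mulVecR S w) w < r := by
  constructor
  · intro hm
    -- The test vector `(-w, 1)` makes the square vanish and leaves exactly the Schur complement.
    have := (mem_posDefCone_iff.1 hm).2 (Fin.snoc (α := fun _ => A) (-w) 1) fun h0 =>
      one_ne_zero' (A := A) <| by simpa using congrFun h0 (Fin.last m)
    rw [dotR_asm_eq _ h hS.1] at this
    simpa [mul_one', dotR, norm_one_alg] using this
  · intro hr
    refine mem_posDefCone_iff.2 ⟨by rw [adj_asm, hS.1], fun v hv => ?_⟩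
    rw [dotR_asm_eq _ h hS.1]
    by_cases ha : v (Fin.last m) = 0
    · simp only [ha, mul_zero_alg, add_zero, norm_zero]
      have : (fun i => v (Fin.castSucc i)) ≠ 0 := fun h0 => hv <| by
        ext i
        exact Fin.lastCases ha (fun i => congrFun h0 i) i
      have := (mem_posDefCone_iff.1 hS).2 _ this
      simpa using this
    · have h1 := dotR_mulVecR_nonneg hS (fun i => v i.castSucc + w i * v (Fin.last m))
      have h2 : 0 < ‖v (Fin.last m)‖ := norm_pos_iff.2 ha
      have h3 := sub_pos.2 hr
      positivity

/-- Splitting off the last entry of a column. -/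
def snocSplit (m : ℕ) (A : Type*) [NormedAddCommGroup A] [InnerProductSpace ℝ A] :
    (Fin (m + 1) → A) ≃ₗ[ℝ] (Fin m → A) × A where
  toFun v := (fun i => v i.castSucc, v (Fin.last m))
  invFun p := Fin.snoc (α := fun _ => A) p.1 p.2
  left_inv v := by
    ext i
    refine Fin.lastCases ?_ (fun i => ?_) i <;> simp
  right_inv p := by simp
  map_add' _ _ := rfl
  map_smul' _ _ := rfl

open LinearMap in
-- Composing with the unipotent map `(v, a) ↦ (v - w a, a)` makes the bordered map block lower
-- triangular, with diagonal blocks `S` and the Schur complement. The latter acts as a real scalar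
-- on `A`, hence the exponent `β`.
theorem det_mulVecR_asm [FiniteDimensional ℝ A]
    (h : (∀ x y z : A, x * y * z = x * (y * z)) ∨ m ≤ 1) (hS : adj S = S) (w : Fin m → A) :
    LinearMap.det (mulVecR (asm S (mulVecR S w) r)) =
      LinearMap.det (mulVecR S) * (r - dotR (mulVecR S w) w) ^ Module.finrank ℝ A := by
  let mulw : A →ₗ[ℝ] (Fin m → A) :=
    { toFun := fun a i => -(w i * a)
      map_add' := fun a b => by ext i; simp [mul_add']; abel
      map_smul' := fun c a => by ext i; simp [mul_smul'] }
  let row : (Fin m → A) →ₗ[ℝ] A :=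
    { toFun := fun v => ∑ j, conj (mulVecR S w j) * v j
      map_add' := fun a b => by simp [mul_add', Finset.sum_add_distrib]
      map_smul' := fun c a => by simp [mul_smul', Finset.smul_sum] }
  have key : ((snocSplit m A).toLinearMap ∘ₗ mulVecR (asm S (mulVecR S w) r) ∘ₗ
      (snocSplit m A).symm.toLinearMap) ∘ₗ
      ((LinearMap.id ∘ₗ fst ℝ (Fin m → A) A + mulw ∘ₗ snd ℝ (Fin m → A) A).prod
        (LinearMap.id ∘ₗ snd ℝ (Fin m → A) A)) =
      (mulVecR S ∘ₗ fst ℝ (Fin m → A) A).prod (row ∘ₗ fst ℝ (Fin m → A) A +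
        ((r - dotR (mulVecR S w) w) • LinearMap.id) ∘ₗ snd ℝ (Fin m → A) A) := by
    refine LinearMap.ext fun p => Prod.ext (funext fun i => ?_) ?_
    · have h1 := congrFun (mulVecR_mul_right h hS w p.2) i
      simp only [mulVecR_apply] at h1
      simp [snocSplit, mulVecR_apply, Fin.sum_univ_castSucc, mulw, mul_add', mul_neg_alg,
        Finset.sum_add_distrib, h1]
    · have h1 := sum_conj_mulVecR_mul h hS w p.2
      simp only [mulVecR_apply] at h1
      simp [snocSplit, mulVecR_apply, Fin.sum_univ_castSucc, mulw, mul_add', mul_neg_alg,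
        Finset.sum_add_distrib, row, RealNormedDivisionAlgebra.smul_mul', one_mul', h1, sub_smul]
      abel
  have hdet := congrArg LinearMap.det key
  rw [LinearMap.det_comp, det_prod_upper, det_prod_lower, LinearMap.det_id, LinearMap.det_id,
    mul_one, mul_one, LinearMap.det_smul, LinearMap.det_id, mul_one] at hdet
  rw [← hdet]
  exact (LinearMap.det_conj _ (snocSplit m A)).symm

theorem exists_mulVecR_eq [FiniteDimensional ℝ A] (hS : S ∈ posDefCone m A) (y : Fin m → A) :
    ∃ w, mulVecR S w = y :=
  (LinearMap.injective_iff_surjective.1 (mulVecR_injective hS)) y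

/-- The inductive description of the cone: since `S` is invertible, the last column can always be
written `S w`. -/
theorem exists_eq_asm [FiniteDimensional ℝ A]
    (h : (∀ x y z : A, x * y * z = x * (y * z)) ∨ m ≤ 1)
    {T : Matrix (Fin (m + 1)) (Fin (m + 1)) A} (hT : T ∈ posDefCone (m + 1) A) :
    ∃ S ∈ posDefCone m A, ∃ (w : Fin m → A) (r : ℝ),
      dotR (mulVecR S w) w < r ∧ T = asm S (mulVecR S w) r := by
  have hT' := hT
  rw [eq_asm_of_adj hT.1] at hT'
  have hS' := mem_posDefCone_of_asm _ _ _ hT'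
  obtain ⟨w, hw⟩ := exists_mulVecR_eq hS' fun i => T i.castSucc (Fin.last m)
  rw [← hw, asm_mem_posDefCone_iff _ h hS'] at hT'
  exact ⟨_, hS', w, _, hT', by rw [hw]; exact eq_asm_of_adj hT.1⟩

end Asm

theorem det_mulVecR_pos [FiniteDimensional ℝ A] {m : ℕ}
    (h : (∀ x y z : A, x * y * z = x * (y * z)) ∨ m ≤ 2)
    {S : Matrix (Fin m) (Fin m) A} (hS : S ∈ posDefCone m A) :
    0 < LinearMap.det (mulVecR S) := by
  induction m with
  | zero => rw [LinearMap.det_eq_one_of_subsingleton]; exact one_pos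
  | succ m ih =>
    have h' : (∀ x y z : A, x * y * z = x * (y * z)) ∨ m ≤ 1 := h.imp_right fun _ => by omega
    obtain ⟨S', hS', w, r, hr, rfl⟩ := exists_eq_asm h' hS
    rw [det_mulVecR_asm _ h' hS'.1]
    exact mul_pos (ih (h.imp_right fun _ => by omega) hS') (pow_pos (sub_pos.2 hr) _)

theorem hdet_pos [FiniteDimensional ℝ A] {m : ℕ}
    (h : (∀ x y z : A, x * y * z = x * (y * z)) ∨ m ≤ 2)
    {S : Matrix (Fin m) (Fin m) A} (hS : S ∈ posDefCone m A) : 0 < hdet S :=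
  Real.rpow_pos_of_pos (det_mulVecR_pos h hS) _

theorem hdet_rpow_finrank [FiniteDimensional ℝ A] {m : ℕ}
    (h : (∀ x y z : A, x * y * z = x * (y * z)) ∨ m ≤ 2)
    {S : Matrix (Fin m) (Fin m) A} (hS : S ∈ posDefCone m A) :
    hdet S ^ (Module.finrank ℝ A : ℝ) = LinearMap.det (mulVecR S) := by
  have : (Module.finrank ℝ A : ℝ) ≠ 0 := by exact_mod_cast (finrank_pos_alg (A := A)).ne'
  rw [hdet, ← Real.rpow_mul (det_mulVecR_pos h hS).le, one_div_mul_cancel this, Real.rpow_one]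

theorem hdet_asm [FiniteDimensional ℝ A] {m : ℕ}
    (h : (∀ x y z : A, x * y * z = x * (y * z)) ∨ m ≤ 1) {S : Matrix (Fin m) (Fin m) A}
    (hS : S ∈ posDefCone m A) (w : Fin m → A) {r : ℝ} (hr : dotR (mulVecR S w) w ≤ r) :
    hdet (asm S (mulVecR S w) r) = hdet S * (r - dotR (mulVecR S w) w) := by
  have hβ : Module.finrank ℝ A ≠ 0 := (finrank_pos_alg (A := A)).ne'
  rw [hdet, det_mulVecR_asm r h hS.1, Real.mul_rpow
    (det_mulVecR_pos (h.imp_right fun _ => by omega) hS).le (pow_nonneg (sub_nonneg.2 hr) _),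
    one_div, Real.pow_rpow_inv_natCast (sub_nonneg.2 hr) hβ, hdet, one_div]

end Matrices

/-! ### Joint image of Lebesgue measure under a linear map and the squared norm -/

section Fibre

open Set

theorem lintegral_sq_Ioi (h : ℝ → ℝ≥0∞) {d : ℕ} (hd : 0 < d) :
    ∫⁻ y in Ioi (0 : ℝ), ENNReal.ofReal (y ^ (d - 1)) * h (y ^ 2) =
      2⁻¹ * ∫⁻ t in Ioi (0 : ℝ), ENNReal.ofReal (t ^ ((d : ℝ) / 2 - 1)) * h t := by
  have himg : (fun y : ℝ => y ^ 2) '' Ioi 0 = Ioi 0 := by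
    ext t
    constructor
    · rintro ⟨y, hy, rfl⟩
      exact pow_pos (mem_Ioi.1 hy) 2
    · intro ht
      exact ⟨√t, Real.sqrt_pos.2 ht, Real.sq_sqrt (le_of_lt ht)⟩
  have hcv := lintegral_image_eq_lintegral_abs_deriv_mul (s := Ioi (0 : ℝ))
    (f := fun y : ℝ => y ^ 2) (f' := fun y => 2 * y) measurableSet_Ioi
    (fun x _ => by simpa using (hasDerivAt_pow 2 x).hasDerivWithinAt)
    (fun x hx y hy hxy => (pow_left_inj₀ (le_of_lt hx) (le_of_lt hy) two_ne_zero).1 hxy)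
    (fun t => ENNReal.ofReal (t ^ ((d : ℝ) / 2 - 1)) * h t)
  rw [himg] at hcv
  rw [hcv, ← lintegral_const_mul' _ _ (by simp)]
  refine setLIntegral_congr_fun measurableSet_Ioi fun y hy => ?_
  have hy' : 0 < y := hy
  have hpow : y * (y ^ 2) ^ ((d : ℝ) / 2 - 1) = y ^ (d - 1) := by
    rw [← Real.rpow_natCast y 2, ← Real.rpow_mul hy'.le, ← Real.rpow_natCast y (d - 1),
      Nat.cast_sub hd]
    nth_rewrite 1 [← Real.rpow_one y]
    rw [← Real.rpow_add hy']
    congr 1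
    push_cast
    ring
  rw [abs_of_pos (by positivity : 0 < 2 * y), ENNReal.ofReal_mul two_pos.le, ← hpow,
    ENNReal.ofReal_mul hy'.le, ENNReal.ofReal_ofNat]
  simp only [← mul_assoc]
  rw [ENNReal.inv_mul_cancel (by simp) (by simp), one_mul]

/-- Polar coordinates followed by `t = ‖z‖²`. The constant is half the area of the unit sphere, but
only its being finite and nonzero is needed, since the total constant is identified later by a
Gaussian integral. -/
theorem exists_lintegral_norm_sq (E : Type*) [NormedAddCommGroup E] [NormedSpace ℝ E]
    [FiniteDimensional ℝ E] [MeasurableSpace E] [BorelSpace E] (μ : Measure E)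
    [μ.IsAddHaarMeasure] (hE : 0 < Module.finrank ℝ E) :
    ∃ c : ℝ≥0∞, c ≠ 0 ∧ c ≠ ∞ ∧ ∀ h : ℝ → ℝ≥0∞, Measurable h →
      ∫⁻ z, h (‖z‖ ^ 2) ∂μ =
        c * ∫⁻ t in Ioi (0 : ℝ),
          ENNReal.ofReal (t ^ ((Module.finrank ℝ E : ℝ) / 2 - 1)) * h t := by
  have : Nontrivial E := Module.nontrivial_of_finrank_pos hE
  refine ⟨μ.toSphere univ * 2⁻¹, ?_, ?_, fun h hh => ?_⟩
  · exact mul_ne_zero (Measure.measure_univ_ne_zero.2 μ.toSphere_ne_zero) (by simp)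
  · exact ENNReal.mul_ne_top (measure_ne_top _ _) (by simp)
  · rw [mul_assoc, ← lintegral_sq_Ioi h hE]
    calc ∫⁻ z, h (‖z‖ ^ 2) ∂μ
        = ∫⁻ z : ({(0 : E)}ᶜ : Set E), h (‖z.1‖ ^ 2) ∂(μ.comap (↑)) := by
          rw [lintegral_subtype_comap (measurableSet_singleton _).compl fun z => h (‖z‖ ^ 2),
            restrict_compl_singleton]
      _ = ∫⁻ p, h (p.2.1 ^ 2) ∂μ.toSphere.prod (.volumeIoiPow (Module.finrank ℝ E - 1)) := by
          have hm : Measurable fun p : Metric.sphere (0 : E) 1 × Ioi (0 : ℝ) => h (p.2.1 ^ 2) :=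
            hh.comp ((measurable_subtype_coe.comp measurable_snd).pow_const 2)
          rw [← μ.measurePreserving_homeomorphUnitSphereProd.lintegral_comp hm]
          simp
      _ = μ.toSphere univ * ∫⁻ t : Ioi (0 : ℝ), h (t.1 ^ 2)
            ∂.volumeIoiPow (Module.finrank ℝ E - 1) := by
          have hm : Measurable fun t : Ioi (0 : ℝ) => h (t.1 ^ 2) :=
            hh.comp (measurable_subtype_coe.pow_const 2)
          have := lintegral_prod_mul (μ := μ.toSphere)
            (ν := Measure.volumeIoiPow (Module.finrank ℝ E - 1)) (f := fun _ => 1)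
            (g := fun t => h (t.1 ^ 2)) aemeasurable_const hm.aemeasurable
          simpa using this
      _ = _ := by
          have hm : Measurable fun t : Ioi (0 : ℝ) => h (t.1 ^ 2) :=
            hh.comp (measurable_subtype_coe.pow_const 2)
          have hm' : Measurable fun t : Ioi (0 : ℝ) =>
              ENNReal.ofReal (t.1 ^ (Module.finrank ℝ E - 1)) :=
            (measurable_subtype_coe.pow_const _).ennreal_ofReal
          rw [Measure.volumeIoiPow, lintegral_withDensity_eq_lintegral_mul _ hm' hm]
          congr 1
          exact lintegral_subtype_comap measurableSet_Ioi
            fun t => ENNReal.ofReal (t ^ (Module.finrank ℝ E - 1)) * h (t ^ 2)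

variable (E F : Type*) [NormedAddCommGroup E] [InnerProductSpace ℝ E]
    [FiniteDimensional ℝ E] [MeasurableSpace E] [BorelSpace E]
    [NormedAddCommGroup F] [InnerProductSpace ℝ F]
    [FiniteDimensional ℝ F] [MeasurableSpace F] [BorelSpace F]

/-- Here `L'` is the adjoint of `L`, `M = L L'`, and `Q y = ⟨y, M⁻¹ y⟩`. On the orthogonal
complement of `ker L` the map `L` is invertible with Jacobian `det M ^ (1/2)`, and `Q (L x)` is the
squared norm of the component of `x` there. So `‖x‖² - Q (L x)` is the squared norm of the kernel
component, whose radial density is the stated power. -/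
theorem exists_lintegral_fibre (h : Module.finrank ℝ F < Module.finrank ℝ E) :
    ∃ c : ℝ≥0∞, c ≠ 0 ∧ c ≠ ∞ ∧ ∀ (L : E →ₗ[ℝ] F) (L' : F →ₗ[ℝ] E) (M : F →ₗ[ℝ] F) (Q : F → ℝ),
      (∀ x v, inner ℝ (L x) v = (inner ℝ x (L' v) : ℝ)) → (∀ v, L (L' v) = M v) →
      Function.Injective M → (∀ w, Q (M w) = inner ℝ (M w) w) →
      ∀ g : F × ℝ → ℝ≥0∞, Measurable g →
        ∫⁻ x, g (L x, ‖x‖ ^ 2) =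
          c * ENNReal.ofReal (LinearMap.det M ^ (-(1 / 2) : ℝ)) *
            ∫⁻ y, ∫⁻ r in Ioi (Q y),
              ENNReal.ofReal ((r - Q y) ^
                (((Module.finrank ℝ E : ℝ) - Module.finrank ℝ F) / 2 - 1)) * g (y, r) := by
  have hd : 0 < Module.finrank ℝ E - Module.finrank ℝ F := Nat.sub_pos_of_lt h
  -- The kernel varies with `L` but its dimension does not, so a model Euclidean space of that
  -- dimension gives a constant independent of `L`.
  obtain ⟨c, hc0, hc1, hc⟩ := exists_lintegral_norm_sq
    (EuclideanSpace ℝ (Fin (Module.finrank ℝ E - Module.finrank ℝ F))) volume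
    (by rw [finrank_euclideanSpace_fin]; exact hd)
  rw [finrank_euclideanSpace_fin, Nat.cast_sub h.le] at hc
  refine ⟨c, hc0, hc1, fun L L' M Q hL hM hMi hQ g hg => ?_⟩
  set e := ((Module.finrank ℝ E : ℝ) - Module.finrank ℝ F) / 2 - 1
  have hMs : Function.Surjective M := LinearMap.injective_iff_surjective.1 hMi
  have hLs : Function.Surjective L := fun y => by
    obtain ⟨w, rfl⟩ := hMs y
    exact ⟨L' w, hM w⟩
  set K := LinearMap.ker L
  have hrank : Module.finrank ℝ F + Module.finrank ℝ K = Module.finrank ℝ E := by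
    rw [← LinearMap.finrank_range_add_finrank_ker L, LinearMap.range_eq_top.2 hLs, finrank_top]
  have hperp := K.finrank_add_finrank_orthogonal
  have hKd : Module.finrank ℝ (EuclideanSpace ℝ (Fin (Module.finrank ℝ E - Module.finrank ℝ F))) =
      Module.finrank ℝ K := by rw [finrank_euclideanSpace_fin]; omega
  have hKF : Module.finrank ℝ F = Module.finrank ℝ Kᗮ := by omega
  let k := (stdOrthonormalBasis ℝ _).equiv (stdOrthonormalBasis ℝ K) (finCongr hKd)
  let j := (stdOrthonormalBasis ℝ F).equiv (stdOrthonormalBasis ℝ Kᗮ) (finCongr hKF)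
  -- `P` is `L` restricted to the complement of its kernel, read in `F` through an isometry so that
  -- its determinant makes sense.
  let P : F →ₗ[ℝ] F := L ∘ₗ Kᗮ.subtype ∘ₗ j.toLinearEquiv.toLinearMap
  have hmem : ∀ v, L' v ∈ Kᗮ := fun v => (Submodule.mem_orthogonal _ _).2 fun u hu => by
    rw [← hL, LinearMap.mem_ker.1 hu, inner_zero_left]
  let P' : F →ₗ[ℝ] F := j.symm.toLinearEquiv.toLinearMap ∘ₗ L'.codRestrict Kᗮ hmem
  have hadj : LinearMap.adjoint P = P' := by
    symm
    rw [LinearMap.eq_adjoint_iff]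
    intro v w
    rw [real_inner_comm, ← j.inner_map_map w]
    simp only [P, P', LinearMap.comp_apply, LinearEquiv.coe_coe,
      LinearIsometryEquiv.coe_toLinearEquiv, LinearIsometryEquiv.apply_symm_apply,
      Submodule.subtype_apply, real_inner_comm (L _) v, hL]
    rfl
  have hPP : P ∘ₗ P' = M := by
    ext v
    simp [P, P', hM]
  -- `M = P P^*`, and a real map has the same determinant as its adjoint.
  have hdetM : LinearMap.det M = LinearMap.det P ^ 2 := by
    rw [← hPP, LinearMap.det_comp, ← hadj, sq]
    congr 1
    rw [← LinearMap.det_toMatrix (stdOrthonormalBasis ℝ F).toBasis,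
      ← LinearMap.det_toMatrix (stdOrthonormalBasis ℝ F).toBasis P, LinearMap.toMatrix_adjoint,
      Matrix.det_conjTranspose]
    simp
  have hdetM0 : LinearMap.det M ≠ 0 :=
    (LinearEquiv.ofInjectiveEndo M hMi).isUnit_det'.ne_zero
  have hdetP0 : LinearMap.det P ≠ 0 := fun h0 => hdetM0 (by rw [hdetM, h0]; simp)
  -- Writing `w = P' u`, one gets `Q (M u) = ⟨P P' u, u⟩ = ‖P' u‖²`.
  have hQP : ∀ w, Q (P w) = ‖w‖ ^ 2 := by
    have hP's : Function.Surjective P' := by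
      refine LinearMap.injective_iff_surjective.1 fun a b hab => hMi ?_
      rw [← hPP]
      exact congrArg P hab
    intro w
    obtain ⟨u, rfl⟩ := hP's w
    have : P (P' u) = M u := LinearMap.congr_fun hPP u
    rw [this, hQ, ← this, ← real_inner_self_eq_norm_sq, ← hadj, LinearMap.adjoint_inner_right]
  have hmp : MeasurePreserving (fun p : EuclideanSpace ℝ
      (Fin (Module.finrank ℝ E - Module.finrank ℝ F)) × F => ((k p.1 : E) + j p.2)) := by
    have h1 := k.measurePreserving.prod j.measurePreserving
    have h2 := WithLp.volume_preserving_toLp (U := K) (V := Kᗮ)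
    have h3 := K.orthogonalDecomposition.symm.measurePreserving
    have h4 := (h3.comp h2).comp h1
    have h5 : (fun p : EuclideanSpace ℝ (Fin (Module.finrank ℝ E - Module.finrank ℝ F)) × F =>
        ((k p.1 : E) + j p.2)) =
        (K.orthogonalDecomposition.symm ∘ WithLp.toLp 2) ∘ Prod.map k j := by
      ext p
      simp
    rw [h5]
    exact h4
  have hLk : ∀ z w, L ((k z : E) + j w) = P w := fun z w => by
    rw [map_add, LinearMap.mem_ker.1 (k z).2, zero_add]; rfl
  have hnorm : ∀ z w, ‖(k z : E) + j w‖ ^ 2 = ‖w‖ ^ 2 + ‖z‖ ^ 2 := fun z w => by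
    have : (inner ℝ (k z : E) (j w : E) : ℝ) = 0 :=
      (Submodule.mem_orthogonal _ _).1 (j w).2 _ (k z).2
    rw [norm_add_sq_real, this, ← Submodule.coe_norm, ← Submodule.coe_norm, k.norm_map, j.norm_map]
    ring
  have hgm : Measurable fun x : E => g (L x, ‖x‖ ^ 2) :=
    hg.comp ((LinearMap.continuous_of_finiteDimensional L).measurable.prodMk
      (measurable_norm.pow_const 2))
  have hPm : Measurable P := (LinearMap.continuous_of_finiteDimensional P).measurable
  rw [← hmp.lintegral_comp hgm]
  simp only [hLk, hnorm]
  set H : F → ℝ≥0∞ := fun y => ∫⁻ r in Ioi (Q y), ENNReal.ofReal ((r - Q y) ^ e) * g (y, r)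
  have hinner : ∀ w, ∫⁻ z : EuclideanSpace ℝ (Fin (Module.finrank ℝ E - Module.finrank ℝ F)),
      g (P w, ‖w‖ ^ 2 + ‖z‖ ^ 2) = c * H (P w) := fun w => by
    rw [hc (fun t => g (P w, ‖w‖ ^ 2 + t)) (hg.comp (by fun_prop))]
    congr 1
    simp only [H, hQP]
    -- The substitution `t = r - ‖w‖²` turns the radial integral over `t > 0` into one over `r > Q
    -- (P w)`.
    rw [← lintegral_indicator measurableSet_Ioi, ← lintegral_indicator measurableSet_Ioi,
      ← lintegral_sub_right_eq_self _ (‖w‖ ^ 2)]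
    refine lintegral_congr fun r => ?_
    by_cases hr : ‖w‖ ^ 2 < r
    · rw [indicator_of_mem (by simpa using hr), indicator_of_mem (by simpa using hr)]
      simp
    · rw [indicator_of_notMem (by simpa using hr), indicator_of_notMem (by simpa using hr)]
  have hmeas : Measurable fun p : EuclideanSpace ℝ
      (Fin (Module.finrank ℝ E - Module.finrank ℝ F)) × F =>
      g (P p.2, ‖p.2‖ ^ 2 + ‖p.1‖ ^ 2) :=
    hg.comp ((hPm.comp measurable_snd).prodMk (by fun_prop))
  rw [Measure.volume_eq_prod, lintegral_prod_symm _ hmeas.aemeasurable]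
  simp only [hinner]
  rw [lintegral_const_mul' _ _ hc1, mul_assoc]
  congr 1
  let Pe : F ≃ᵐ F := (LinearEquiv.ofIsUnitDet (f := P) (v := Module.finBasis ℝ F)
    (v' := Module.finBasis ℝ F) (by
      rw [LinearMap.det_toMatrix]; exact hdetP0.isUnit)).toContinuousLinearEquiv.toHomeomorph.toMeasurableEquiv
  have hPe : ∀ w, Pe w = P w := fun w => rfl
  have hmap := Measure.map_linearMap_addHaar_eq_smul_addHaar (volume : Measure F) hdetP0
  calc ∫⁻ w, H (P w) = ∫⁻ w, H (Pe w) := rfl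
    _ = ∫⁻ y, H y ∂(volume.map Pe) := (lintegral_map_equiv H Pe).symm
    _ = ∫⁻ y, H y ∂(volume.map P) := rfl
    _ = _ := by
      rw [hmap, lintegral_smul_measure, smul_eq_mul]
      congr 2
      rw [hdetM, ← sq_abs, ← Real.rpow_natCast, ← Real.rpow_mul (abs_nonneg _), abs_inv,
        ← Real.rpow_neg_one]
      norm_num

end Fibre

/-! ### The law of the border produced by a new column -/

section Column

variable {A : Type*} [NormedAddCommGroup A] [InnerProductSpace ℝ A]
  [FiniteDimensional ℝ A] [MeasurableSpace A] [BorelSpace A]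

/-- Both the product measure and the Euclidean volume are Haar measures, so they are proportional.
The Euclidean structure is needed because the fibre lemma works in an inner product space, whereas
plain functions carry the sup norm. -/
theorem exists_lintegral_ofLp (A : Type*) [NormedAddCommGroup A] [InnerProductSpace ℝ A]
    [FiniteDimensional ℝ A] [MeasurableSpace A] [BorelSpace A] (n : ℕ) :
    ∃ c : ℝ≥0∞, c ≠ 0 ∧ c ≠ ∞ ∧ ∀ f : (Fin n → A) → ℝ≥0∞,
      ∫⁻ x, f x = c * ∫⁻ x : PiLp 2 (fun _ : Fin n => A), f x.ofLp := by
  let e := PiLp.continuousLinearEquiv 2 ℝ (fun _ : Fin n => A)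
  let e' := e.toHomeomorph.toMeasurableEquiv
  have hH : (Measure.map e volume).IsAddHaarMeasure := e.isAddHaarMeasure_map volume
  refine ⟨(volume : Measure (Fin n → A)).addHaarScalarFactor (Measure.map e volume), ?_, by simp,
    fun f => ?_⟩
  · exact_mod_cast (Measure.addHaarScalarFactor_pos_of_isAddHaarMeasure _ _).ne'
  · conv_lhs => rw [Measure.isAddLeftInvariant_eq_smul volume (Measure.map e volume)]
    rw [lintegral_smul_measure]
    exact congrArg _ (lintegral_map_equiv f e')

theorem finrank_piLp (A : Type*) [NormedAddCommGroup A] [InnerProductSpace ℝ A]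
    [FiniteDimensional ℝ A] (n : ℕ) :
    Module.finrank ℝ (PiLp 2 (fun _ : Fin n => A)) = n * Module.finrank ℝ A := by
  rw [(WithLp.linearEquiv 2 ℝ (Fin n → A)).finrank_eq, Module.finrank_pi_fintype]
  simp

variable [RealNormedDivisionAlgebra A]

open Classical in
/-- The contribution of the last column to the density of the Gram matrix. -/
noncomputable def colKernel {m : ℕ} (e : ℝ) (S : Matrix (Fin m) (Fin m) A) (y : Fin m → A) (r : ℝ) : ℝ≥0∞ :=
  if asm S y r ∈ posDefCone (m + 1) A then ENNReal.ofReal ((hdet (asm S y r) / hdet S) ^ e) else 0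

/-- The fibre lemma with `L = X^*`, `L' = X` and `M = S = X^* X`. The factor `det M ^ (-1/2)`
becomes `|S| ^ (-β/2)`, because `hdet` is the `β`-th root of the real determinant. -/
theorem exists_lintegral_column (A : Type*) [NormedAddCommGroup A] [InnerProductSpace ℝ A]
    [FiniteDimensional ℝ A] [MeasurableSpace A] [BorelSpace A] [RealNormedDivisionAlgebra A]
    {n m : ℕ} (h : (∀ x y z : A, x * y * z = x * (y * z)) ∨ m ≤ 1) (hnm : m < n) :
    ∃ c : ℝ≥0∞, c ≠ 0 ∧ c ≠ ∞ ∧ ∀ X : Matrix (Fin n) (Fin m) A, adj X * X ∈ posDefCone m A →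
      ∀ g : (Fin m → A) × ℝ → ℝ≥0∞, Measurable g →
      ∫⁻ x : Fin n → A, g (actL (adj X) x, dotR x x) =
        c * (ENNReal.ofReal (hdet (adj X * X) ^ (-((Module.finrank ℝ A : ℝ) / 2))) *
          ∫⁻ y : Fin m → A, ∫⁻ r,
            colKernel (((n : ℝ) - m) * Module.finrank ℝ A / 2 - 1) (adj X * X) y r * g (y, r)) := by
  obtain ⟨c₁, h10, h11, h1⟩ := exists_lintegral_ofLp A n
  obtain ⟨c₂, h20, h21, h2⟩ := exists_lintegral_ofLp A m
  have hβ := finrank_pos_alg (A := A)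
  obtain ⟨c, hc0, hc1, hc⟩ := exists_lintegral_fibre (PiLp 2 (fun _ : Fin n => A))
    (PiLp 2 (fun _ : Fin m => A)) (by
      rw [finrank_piLp, finrank_piLp]; exact Nat.mul_lt_mul_of_pos_right hnm hβ)
  refine ⟨c₁ * (c * c₂⁻¹), by simp [h10, hc0, h21], by simp [ENNReal.mul_eq_top, *],
    fun X hX g hg => ?_⟩
  set S := adj X * X
  let en := WithLp.linearEquiv 2 ℝ (Fin n → A)
  let em := WithLp.linearEquiv 2 ℝ (Fin m → A)
  have hinj := mulVecR_injective hX
  let Si : (Fin m → A) ≃ₗ[ℝ] (Fin m → A) := LinearEquiv.ofInjectiveEndo (mulVecR S) hinj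
  have hSi : ∀ y, mulVecR S (Si.symm y) = y := fun y => Si.apply_symm_apply y
  have h' : (∀ x y z : A, x * y * z = x * (y * z)) ∨ m ≤ 2 := h.imp_right fun _ => by omega
  have hdetpos := hdet_pos h' hX
  have hfib := hc (em.symm.toLinearMap ∘ₗ actL (adj X) ∘ₗ en.toLinearMap)
    (en.symm.toLinearMap ∘ₗ actL X ∘ₗ em.toLinearMap)
    (em.symm.toLinearMap ∘ₗ mulVecR S ∘ₗ em.symm.symm.toLinearMap)
    (fun y => dotR y.ofLp (Si.symm y.ofLp))
    (fun x v => by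
      rw [PiLp.inner_apply, PiLp.inner_apply]
      exact dotR_actL_adj X x.ofLp v.ofLp)
    (fun v => congrArg (WithLp.toLp 2) (actL_adj_actL h X v.ofLp))
    (fun v w hvw => (WithLp.linearEquiv 2 ℝ (Fin m → A)).injective
      (hinj ((WithLp.linearEquiv 2 ℝ (Fin m → A)).symm.injective hvw)))
    (fun w => by
      have : Si.symm (mulVecR S w.ofLp) = w.ofLp := Si.symm_apply_apply w.ofLp
      rw [PiLp.inner_apply]
      show dotR (mulVecR S w.ofLp) (Si.symm (mulVecR S w.ofLp)) = dotR (mulVecR S w.ofLp) w.ofLp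
      rw [this])
    (fun p => g (p.1.ofLp, p.2))
    (hg.comp (((WithLp.measurable_ofLp 2 _).comp measurable_fst).prodMk measurable_snd))
  rw [LinearMap.det_conj, finrank_piLp, finrank_piLp] at hfib
  have hnorm : ∀ x : PiLp 2 (fun _ : Fin n => A), dotR x.ofLp x.ofLp = ‖x‖ ^ 2 := fun x => by
    rw [PiLp.norm_sq_eq_of_L2]
    exact Finset.sum_congr rfl fun _ _ => real_inner_self_eq_norm_sq _
  rw [h1, h2]
  simp only [hnorm]
  refine (congrArg (c₁ * ·) hfib).trans ?_
  rw [← hdet_rpow_finrank h' hX, ← Real.rpow_mul hdetpos.le]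
  have hrw : (Module.finrank ℝ A : ℝ) * -(1 / 2) = -((Module.finrank ℝ A : ℝ) / 2) := by ring
  rw [hrw]
  have hker : ∀ y : Fin m → A, ∫⁻ r in Set.Ioi (dotR y (Si.symm y)),
      ENNReal.ofReal ((r - dotR y (Si.symm y)) ^
        ((((n * Module.finrank ℝ A : ℕ) : ℝ) - (m * Module.finrank ℝ A : ℕ)) / 2 - 1)) * g (y, r) =
      ∫⁻ r, colKernel (((n : ℝ) - m) * Module.finrank ℝ A / 2 - 1) S y r * g (y, r) := fun y => by
    rw [← lintegral_indicator measurableSet_Ioi]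
    refine lintegral_congr fun r => ?_
    -- The range `r > ⟨y, S⁻¹ y⟩` is exactly positive definiteness of the bordered matrix, and there
    -- `r - ⟨y, S⁻¹ y⟩` is the ratio of determinants.
    have hiff := asm_mem_posDefCone_iff r h hX (Si.symm y)
    rw [hSi] at hiff
    by_cases hr : dotR y (Si.symm y) < r
    · have hd := hdet_asm h hX (Si.symm y) (r := r) (by rw [hSi]; exact hr.le)
      rw [hSi] at hd
      rw [Set.indicator_of_mem (by simpa using hr), colKernel, if_pos (hiff.2 hr), hd,
        mul_div_cancel_left₀ _ hdetpos.ne']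
      congr 4
      push_cast
      ring
    · rw [Set.indicator_of_notMem (by simpa using hr), colKernel, if_neg (fun h => hr (hiff.1 h)),
        zero_mul]
  simp only [hker]
  have hcc : c₂⁻¹ * c₂ = 1 := ENNReal.inv_mul_cancel h20 h21
  have fin : ∀ a b : ℝ≥0∞, c₁ * (c * a * b) = c₁ * (c * c₂⁻¹) * (a * (c₂ * b)) := fun a b =>
    calc c₁ * (c * a * b) = c₁ * (c * (c₂⁻¹ * c₂) * a * b) := by rw [hcc, mul_one]
      _ = _ := by ring
  exact fin _ _

end Column

/-! ### Continuity and measurability -/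

section Measurability

variable {A : Type*} [NormedAddCommGroup A] [InnerProductSpace ℝ A] [RealNormedDivisionAlgebra A]

theorem continuous_mul_alg : Continuous fun p : A × A => p.1 * p.2 := by
  have : IsBoundedBilinearMap ℝ fun p : A × A => p.1 * p.2 :=
    { add_left := RealNormedDivisionAlgebra.add_mul'
      smul_left := RealNormedDivisionAlgebra.smul_mul'
      add_right := RealNormedDivisionAlgebra.mul_add'
      smul_right := RealNormedDivisionAlgebra.mul_smul'
      bound := ⟨1, one_pos, fun x y => by rw [norm_mul_alg, one_mul]⟩ }
  exact this.continuous

theorem continuous_conj : Continuous (conj : A → A) := (conjE A).continuous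

theorem continuous_re : Continuous (re : A → ℝ) := continuous_const.inner continuous_id

theorem continuous_matMul {T : Type*} [TopologicalSpace T] {n m l : ℕ}
    {f : T → Matrix (Fin n) (Fin m) A} {g : T → Matrix (Fin m) (Fin l) A}
    (hf : Continuous f) (hg : Continuous g) : Continuous fun t => f t * g t := by
  refine continuous_matrix fun i j => ?_
  simp only [Matrix.mul_apply]
  exact continuous_finsetSum _ fun k _ =>
    continuous_mul_alg.comp ((hf.matrix_elem i k).prodMk (hg.matrix_elem k j))

theorem continuous_adj {n m : ℕ} : Continuous (adj : Matrix (Fin n) (Fin m) A → _) :=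
  continuous_matrix fun i j => continuous_conj.comp (continuous_id.matrix_elem j i)

theorem continuous_reTr {m : ℕ} : Continuous (reTr : Matrix (Fin m) (Fin m) A → ℝ) :=
  continuous_re.comp (continuous_finsetSum _ fun i _ => continuous_id.matrix_elem i i)

theorem continuous_mulVecR_apply {m : ℕ} (i : Fin m) :
    Continuous fun p : Matrix (Fin m) (Fin m) A × (Fin m → A) => mulVecR p.1 p.2 i := by
  simp only [mulVecR_apply]
  exact continuous_finsetSum _ fun k _ => continuous_mul_alg.comp
    ((continuous_fst.matrix_elem i k).prodMk ((continuous_apply k).comp continuous_snd))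

theorem continuous_dotR_mulVecR {m : ℕ} :
    Continuous fun p : Matrix (Fin m) (Fin m) A × (Fin m → A) => dotR p.2 (mulVecR p.1 p.2) :=
  continuous_finsetSum _ fun i _ => ((continuous_apply i).comp continuous_snd).inner
    (continuous_mulVecR_apply i)

theorem continuous_asm {T : Type*} [TopologicalSpace T] {m : ℕ}
    {S : T → Matrix (Fin m) (Fin m) A} {y : T → Fin m → A} {r : T → ℝ}
    (hS : Continuous S) (hy : Continuous y) (hr : Continuous r) :
    Continuous fun t => asm (S t) (y t) (r t) := by
  refine continuous_matrix fun i j => ?_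
  refine Fin.lastCases ?_ (fun i => ?_) i <;> refine Fin.lastCases ?_ (fun j => ?_) j
  · simpa using! hr.smul continuous_const
  · simpa using! continuous_conj.comp ((continuous_apply j).comp hy)
  · simpa using! (continuous_apply i).comp hy
  · simpa using hS.matrix_elem i j

theorem dotR_mulVecR_smul {m : ℕ} (S : Matrix (Fin m) (Fin m) A) (c : ℝ) (v : Fin m → A) :
    dotR (c • v) (mulVecR S (c • v)) = c ^ 2 * dotR v (mulVecR S v) := by
  simp only [map_smul, dotR, Pi.smul_apply, real_inner_smul_left, real_inner_smul_right,
    Finset.mul_sum]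
  exact Finset.sum_congr rfl fun i _ => by ring

section

variable [MeasurableSpace A] [BorelSpace A]

theorem measurable_hermOf (m : ℕ) : Measurable (hermOf m A) := by
  refine measurable_pi_iff.2 fun i => measurable_pi_iff.2 fun j => ?_
  simp only [hermOf, Matrix.of_apply]
  split_ifs with h1 h2
  · exact (measurable_pi_apply _).comp measurable_snd
  · exact continuous_conj.measurable.comp ((measurable_pi_apply _).comp measurable_snd)
  · exact ((measurable_pi_apply i).comp measurable_fst).smul_const _

end

variable [FiniteDimensional ℝ A]

theorem continuous_det_mulVecR {m : ℕ} :
    Continuous fun S : Matrix (Fin m) (Fin m) A => LinearMap.det (mulVecR S) := by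
  let b := Module.finBasis ℝ (Fin m → A)
  simp only [← LinearMap.det_toMatrix b]
  refine Continuous.matrix_det (continuous_matrix fun i j => ?_)
  simp only [LinearMap.toMatrix_apply]
  refine (LinearMap.continuous_of_finiteDimensional (b.coord i)).comp ?_
  exact continuous_pi fun k =>
    (continuous_mulVecR_apply k).comp (continuous_id.prodMk continuous_const)

variable [MeasurableSpace A] [BorelSpace A]

instance instBorelSpaceMatrix {n m : ℕ} : BorelSpace (Matrix (Fin n) (Fin m) A) :=
  inferInstanceAs (BorelSpace (Fin n → Fin m → A))

instance instSecondCountableTopologyMatrix {n m : ℕ} :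
    SecondCountableTopology (Matrix (Fin n) (Fin m) A) :=
  inferInstanceAs (SecondCountableTopology (Fin n → Fin m → A))

theorem measurable_hdet {m : ℕ} : Measurable (hdet : Matrix (Fin m) (Fin m) A → ℝ) :=
  continuous_det_mulVecR.measurable.pow_const _

theorem measurable_highestWeight {m : ℕ} (τ : Fin m → ℝ) :
    Measurable (highestWeight τ : Matrix (Fin m) (Fin m) A → ℝ) := by
  refine Finset.measurable_prod _ fun i _ => Measurable.pow_const (measurable_hdet.comp ?_) _
  exact (continuous_id.matrix_submatrix _ _).measurable

/-- By compactness of the unit sphere a positive definite form is bounded below by some `‖v‖² / (k +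
1)`; this writes the cone as a countable union of closed sets. -/
theorem measurableSet_posDefCone (m : ℕ) : MeasurableSet (posDefCone m A) := by
  have key : posDefCone m A = {S | adj S = S} ∩
      ⋃ k : ℕ, {S | ∀ v, ‖v‖ ^ 2 / (k + 1) ≤ dotR v (mulVecR S v)} := by
    ext S
    simp only [mem_posDefCone_iff, Set.mem_inter_iff, Set.mem_ofPred_eq, Set.mem_iUnion]
    refine and_congr_right fun _ => ⟨fun h => ?_, fun ⟨k, hk⟩ v hv => ?_⟩
    · by_cases hne : (Metric.sphere (0 : Fin m → A) 1).Nonempty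
      · obtain ⟨u, hu, hmin⟩ := (isCompact_sphere (0 : Fin m → A) 1).exists_isMinOn hne
          (continuous_dotR_mulVecR.comp (continuous_const.prodMk continuous_id)).continuousOn
          (f := fun v => dotR v (mulVecR S v))
        have hu0 : u ≠ 0 := fun h0 => by simp [h0] at hu
        obtain ⟨k, hk⟩ := exists_nat_one_div_lt (h u hu0)
        refine ⟨k, fun v => ?_⟩
        by_cases hv : v = 0
        · simp [hv, dotR]
        · have hn : ‖v‖ ≠ 0 := norm_ne_zero_iff.2 hv
          have hm := hmin (a := ‖v‖⁻¹ • v) (by simp [norm_smul, hn])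
          simp only [Set.mem_ofPred_eq, dotR_mulVecR_smul] at hm
          have := hk.le.trans hm
          rw [inv_pow, ← div_eq_inv_mul, le_div_iff₀ (by positivity)] at this
          calc _ = 1 / ((k : ℝ) + 1) * ‖v‖ ^ 2 := by ring
            _ ≤ _ := this
      · refine ⟨0, fun v => ?_⟩
        by_cases hv : v = 0
        · simp [hv, dotR]
        · exact absurd ⟨‖v‖⁻¹ • v, by simp [norm_smul, hv]⟩ hne
    · refine lt_of_lt_of_le ?_ (hk v)
      have : 0 < ‖v‖ := norm_pos_iff.2 hv
      positivity
  rw [key]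
  refine (isClosed_eq continuous_adj continuous_id).measurableSet.inter
    (MeasurableSet.iUnion fun k => IsClosed.measurableSet ?_)
  simp only [Set.ofPred_forall]
  exact isClosed_iInter fun v => isClosed_le continuous_const
    (continuous_dotR_mulVecR.comp (continuous_id.prodMk continuous_const))

theorem measurable_gram {n m : ℕ} :
    Measurable fun X : Matrix (Fin n) (Fin m) A => adj X * X :=
  (continuous_matMul continuous_adj continuous_id).measurable

theorem measurable_asm {m : ℕ} :
    Measurable fun p : Matrix (Fin m) (Fin m) A × (Fin m → A) × ℝ => asm p.1 p.2.1 p.2.2 :=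
  (continuous_asm continuous_fst (continuous_fst.comp continuous_snd)
    (continuous_snd.comp continuous_snd)).measurable

theorem measurable_colKernel {m : ℕ} (e : ℝ) :
    Measurable fun p : Matrix (Fin m) (Fin m) A × (Fin m → A) × ℝ =>
      colKernel e p.1 p.2.1 p.2.2 := by
  refine Measurable.ite (measurable_asm (measurableSet_posDefCone (A := A) (m + 1))) ?_
    measurable_const
  exact (((measurable_hdet.comp measurable_asm).div
    (measurable_hdet.comp measurable_fst)).pow_const e).ennreal_ofReal

end Measurability

/-! ### Splitting the Lebesgue measures along the last column -/

section Decomposition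

theorem lintegral_prod_regroup {α β γ δ : Type*} [MeasurableSpace α] [MeasurableSpace β]
    [MeasurableSpace γ] [MeasurableSpace δ] (μ : Measure α) (ν : Measure β) (ξ : Measure γ)
    (η : Measure δ) [SFinite μ] [SFinite ν] [SFinite ξ] [SFinite η]
    {H : (α × β) × (γ × δ) → ℝ≥0∞} (hH : Measurable H) :
    ∫⁻ p, H p ∂((μ.prod ν).prod (ξ.prod η)) =
      ∫⁻ q, ∫⁻ y, ∫⁻ r, H ((r, q.1), (q.2, y)) ∂μ ∂η ∂(ν.prod ξ) := by
  have h1 := (measurePreserving_prodAssoc μ ν (ξ.prod η)).symm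
  have h2 := (MeasurePreserving.id μ).prod (measurePreserving_prodAssoc ν ξ η)
  have h3 := h1.comp h2
  have h4 : Measurable fun p : α × ((β × γ) × δ) => H ((p.1, p.2.1.1), (p.2.1.2, p.2.2)) :=
    hH.comp h3.measurable
  rw [← h3.lintegral_comp hH]
  refine (lintegral_prod_symm _ h4.aemeasurable).trans ?_
  exact lintegral_prod _ h4.lintegral_prod_left'.aemeasurable

/-- The positions below the diagonal of an `(m + 1) × (m + 1)` matrix are those of the leading
block, together with the last row. -/
noncomputable def lowerEquiv (m : ℕ) :
    {p : Fin m × Fin m // p.2 < p.1} ⊕ Fin m ≃ {p : Fin (m + 1) × Fin (m + 1) // p.2 < p.1} :=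
  Equiv.ofBijective
    (Sum.elim (fun p => ⟨(p.1.1.castSucc, p.1.2.castSucc), Fin.castSucc_lt_castSucc_iff.2 p.2⟩)
      fun j => ⟨(Fin.last m, j.castSucc), Fin.castSucc_lt_last j⟩) <| by
    constructor
    · rintro (⟨⟨a, b⟩, h⟩ | a) (⟨⟨c, d⟩, h'⟩ | c) hab
      · simpa using hab
      · have := congrArg (fun q => q.1.1) hab
        exact absurd this (Fin.castSucc_lt_last a).ne
      · have := congrArg (fun q => q.1.1) hab
        exact absurd this (Fin.castSucc_lt_last c).ne'
      · simpa using hab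
    · rintro ⟨⟨i, j⟩, h⟩
      have hj : j ≠ Fin.last m := fun h0 => absurd (h0 ▸ h) (Fin.le_last i).not_gt
      obtain ⟨j, rfl⟩ := Fin.exists_castSucc_eq.2 hj
      by_cases hi : i = Fin.last m
      · subst hi
        exact ⟨Sum.inr j, rfl⟩
      · obtain ⟨i, rfl⟩ := Fin.exists_castSucc_eq.2 hi
        exact ⟨Sum.inl ⟨(i, j), Fin.castSucc_lt_castSucc_iff.1 h⟩, rfl⟩

variable {A : Type*} [NormedAddCommGroup A] [InnerProductSpace ℝ A]

/-- Append a column to a matrix. -/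
def appendCol {n m : ℕ} (X : Matrix (Fin n) (Fin m) A) (x : Fin n → A) :
    Matrix (Fin n) (Fin (m + 1)) A :=
  Matrix.of fun i => Fin.snoc (α := fun _ => A) (X i) (x i)

section

variable [RealNormedDivisionAlgebra A]

/-- The conjugation appears because `hermOf` is parametrised by entries below the diagonal, hence by
the last row, while `asm` takes the last column. -/
theorem hermOf_succ {m : ℕ} (d : Fin m → ℝ) (r : ℝ) (l : {p : Fin m × Fin m // p.2 < p.1} → A)
    (y : Fin m → A) (d' : Fin (m + 1) → ℝ)
    (l' : {p : Fin (m + 1) × Fin (m + 1) // p.2 < p.1} → A)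
    (hd : ∀ i, d' i.castSucc = d i) (hr : d' (Fin.last m) = r)
    (hl : ∀ p, l' (lowerEquiv m (Sum.inl p)) = l p) (hy : ∀ j, l' (lowerEquiv m (Sum.inr j)) = y j) :
    hermOf (m + 1) A (d', l') = asm (hermOf m A (d, l)) (fun j => conj (y j)) r := by
  ext i j
  refine Fin.lastCases ?_ (fun i => ?_) i <;> refine Fin.lastCases ?_ (fun j => ?_) j
  · simp [hermOf, hr]
  · rw [asm_last_castSucc, conj_conj, ← hy]
    simp only [hermOf, Matrix.of_apply, Fin.castSucc_lt_last, dif_pos]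
    rfl
  · rw [asm_castSucc_last, ← hy]
    simp only [hermOf, Matrix.of_apply, Fin.castSucc_lt_last, dif_pos,
      (Fin.castSucc_lt_last i).not_gt, dif_neg, not_false_eq_true]
    rfl
  · rw [asm_castSucc_castSucc]
    simp only [hermOf, Matrix.of_apply, Fin.castSucc_lt_castSucc_iff, hd, ← hl]
    rfl

end

variable [FiniteDimensional ℝ A] [MeasurableSpace A] [BorelSpace A]

theorem lintegral_matVolume_succ {n m : ℕ} {f : Matrix (Fin n) (Fin (m + 1)) A → ℝ≥0∞}
    (hf : Measurable f) :
    ∫⁻ X, f X ∂(matVolume n (m + 1) A) =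
      ∫⁻ X, ∫⁻ x, f (appendCol X x) ∂(volume : Measure (Fin n → A)) ∂(matVolume n m A) := by
  have h1 := (volume_measurePreserving_arrowProdEquivProdArrow A (Fin m → A) (Fin n)).symm
  have h2 := volume_preserving_pi fun _ : Fin n =>
    (volume_preserving_piFinSuccAbove (fun _ : Fin (m + 1) => A) (Fin.last m)).symm
  have h3 := h2.comp h1
  have h4 : ∀ p : (Fin n → A) × (Fin n → Fin m → A),
      ((fun (a : Fin n → A × (Fin m → A)) i =>
        (MeasurableEquiv.piFinSuccAbove (fun _ : Fin (m + 1) => A) (Fin.last m)).symm (a i)) ∘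
        (MeasurableEquiv.arrowProdEquivProdArrow A (Fin m → A) (Fin n)).symm) p =
        appendCol p.2 p.1 := fun p => by
    funext i
    exact Fin.insertNth_last (α := fun _ => A) (p.1 i) (p.2 i)
  have h5 : ∫⁻ X, f X ∂(matVolume n (m + 1) A) = ∫⁻ p, f (appendCol p.2 p.1)
      ∂((volume : Measure (Fin n → A)).prod (volume : Measure (Fin n → Fin m → A))) := by
    simp only [← h4]
    exact (h3.lintegral_comp (f := f) hf).symm
  rw [h5, lintegral_prod_symm]
  · rfl
  · simp only [← h4]
    exact (hf.comp h3.measurable).aemeasurable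

variable [RealNormedDivisionAlgebra A]

theorem lintegral_hermVolume {m : ℕ} {f : Matrix (Fin m) (Fin m) A → ℝ≥0∞} (hf : Measurable f) :
    ∫⁻ S, f S ∂(hermVolume m A) =
      ∫⁻ c, f (hermOf m A c) ∂((volume : Measure (Fin m → ℝ)).prod
        (volume : Measure ({p : Fin m × Fin m // p.2 < p.1} → A))) :=
  lintegral_map hf (measurable_hermOf m)

theorem exists_measurePreserving_snoc (m : ℕ) :
    ∃ φ : ℝ × (Fin m → ℝ) → (Fin (m + 1) → ℝ), MeasurePreserving φ ∧
      (∀ p i, φ p i.castSucc = p.2 i) ∧ ∀ p, φ p (Fin.last m) = p.1 :=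
  ⟨_, (volume_preserving_piFinSuccAbove (fun _ : Fin (m + 1) => ℝ) (Fin.last m)).symm,
    fun p i => by simp [MeasurableEquiv.piFinSuccAbove],
    fun p => by simp [MeasurableEquiv.piFinSuccAbove]⟩

theorem exists_measurePreserving_lower (A : Type*) [NormedAddCommGroup A] [InnerProductSpace ℝ A]
    [FiniteDimensional ℝ A] [MeasurableSpace A] [BorelSpace A] (m : ℕ) :
    ∃ ψ : ({p : Fin m × Fin m // p.2 < p.1} → A) × (Fin m → A) →
      ({p : Fin (m + 1) × Fin (m + 1) // p.2 < p.1} → A), MeasurePreserving ψ ∧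
      (∀ p i, ψ p (lowerEquiv m (Sum.inl i)) = p.1 i) ∧
      ∀ p i, ψ p (lowerEquiv m (Sum.inr i)) = p.2 i :=
  ⟨_, (volume_measurePreserving_piCongrLeft (fun _ => A) (lowerEquiv m)).comp
    (volume_measurePreserving_sumPiEquivProdPi_symm
      (fun _ : {p : Fin m × Fin m // p.2 < p.1} ⊕ Fin m => A)),
    fun p i => by
      simp [MeasurableEquiv.coe_piCongrLeft, Equiv.piCongrLeft_apply_apply,
        MeasurableEquiv.coe_sumPiEquivProdPi_symm],
    fun p i => by
      simp [MeasurableEquiv.coe_piCongrLeft, Equiv.piCongrLeft_apply_apply,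
        MeasurableEquiv.coe_sumPiEquivProdPi_symm]⟩

theorem lintegral_hermVolume_succ {m : ℕ}
    {f : Matrix (Fin (m + 1)) (Fin (m + 1)) A → ℝ≥0∞} (hf : Measurable f) :
    ∫⁻ S, f S ∂(hermVolume (m + 1) A) =
      ∫⁻ S, ∫⁻ y, ∫⁻ r, f (asm S y r) ∂(volume : Measure ℝ) ∂(volume : Measure (Fin m → A))
        ∂(hermVolume m A) := by
  obtain ⟨φ, hφ, hφd, hφr⟩ := exists_measurePreserving_snoc m
  obtain ⟨ψ, hψ, hψl, hψy⟩ := exists_measurePreserving_lower A m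
  have h3 := hφ.prod hψ
  have hF : Measurable fun c => f (hermOf (m + 1) A c) := hf.comp (measurable_hermOf _)
  -- Conjugation is a linear isometry, so passing from last row to last column costs no Jacobian.
  have hconj : MeasurePreserving fun (y : Fin m → A) j => conj (y j) :=
    volume_preserving_pi fun _ => (conjE A).measurePreserving
  have hasm : Measurable fun p : (Matrix (Fin m) (Fin m) A × (Fin m → A)) × ℝ =>
      f (asm p.1.1 p.1.2 p.2) :=
    hf.comp (measurable_asm.comp (measurable_fst.fst.prodMk
      (measurable_fst.snd.prodMk measurable_snd)))
  have hΦ : Measurable fun p : Matrix (Fin m) (Fin m) A × (Fin m → A) =>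
      ∫⁻ r, f (asm p.1 p.2 r) ∂(volume : Measure ℝ) := hasm.lintegral_prod_right'
  rw [lintegral_hermVolume hf, lintegral_hermVolume hΦ.lintegral_prod_right',
    ← h3.lintegral_comp hF]
  refine (lintegral_prod_regroup (volume : Measure ℝ) (volume : Measure (Fin m → ℝ))
    (volume : Measure ({p : Fin m × Fin m // p.2 < p.1} → A)) (volume : Measure (Fin m → A))
    (hF.comp h3.measurable)).trans ?_
  refine lintegral_congr fun q => ?_
  have hΦq : Measurable fun y : Fin m → A => ∫⁻ r, f (asm (hermOf m A q) y r) := by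
    have hm : Measurable fun p : (Fin m → A) × ℝ => f (asm (hermOf m A q) p.1 p.2) :=
      hf.comp (continuous_asm continuous_const continuous_fst continuous_snd).measurable
    exact hm.lintegral_prod_right'
  have hq : ∀ y r, hermOf (m + 1) A (φ (r, q.1), ψ (q.2, y)) =
      asm (hermOf m A q) (fun j => conj (y j)) r := fun y r =>
    hermOf_succ q.1 r q.2 y _ _ (hφd _) (hφr _) (hψl _) (hψy _)
  have hq' := hconj.lintegral_comp hΦq
  simp only [Function.comp_apply, Prod.map_apply, hq]
  exact hq'

end Decomposition

/-! ### The density of the Gram matrix, by induction on columns -/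

section Gram

section

variable {A : Type*} [NormedAddCommGroup A] [InnerProductSpace ℝ A] [RealNormedDivisionAlgebra A]

theorem gram_appendCol {n m : ℕ} (X : Matrix (Fin n) (Fin m) A) (x : Fin n → A) :
    adj (appendCol X x) * appendCol X x = asm (adj X * X) (actL (adj X) x) (dotR x x) := by
  ext i j
  refine Fin.lastCases ?_ (fun i => ?_) i <;> refine Fin.lastCases ?_ (fun j => ?_) j
  · simp [Matrix.mul_apply, adj_apply, appendCol, conj_mul_self, dotR, Finset.sum_smul]
  · simp [Matrix.mul_apply, adj_apply, appendCol, actL_apply, conj_sum, conj_mul, conj_conj]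
  · simp [Matrix.mul_apply, adj_apply, appendCol, actL_apply]
  · simp [Matrix.mul_apply, adj_apply, appendCol]

theorem posDefCone_zero : posDefCone 0 A = Set.univ := by
  ext S
  simp only [Set.mem_univ, iff_true]
  exact ⟨Subsingleton.elim _ _, fun v hv => absurd (Subsingleton.elim _ _) hv⟩

theorem hdet_zero_dim (S : Matrix (Fin 0) (Fin 0) A) : hdet S = 1 := by
  rw [hdet, LinearMap.det_eq_one_of_subsingleton, Real.one_rpow]

variable [FiniteDimensional ℝ A]

/-- The exponents of `|S|` sum to zero: `(n - m + 1) β/2 - 1` from the previous stage, `-β/2` from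
the Jacobian, and `-((n - m) β/2 - 1)` from the Schur complement. What remains is the density of the
next stage, whose exponent is `(n - m) β/2 - 1`. -/
theorem colKernel_mul_eq {n m : ℕ} (h : (∀ x y z : A, x * y * z = x * (y * z)) ∨ m ≤ 1)
    {S : Matrix (Fin m) (Fin m) A} (hS : S ∈ posDefCone m A) (y : Fin m → A) (r : ℝ) (t : ℝ≥0∞) :
    ENNReal.ofReal (hdet S ^ (((n : ℝ) - m + 1) * Module.finrank ℝ A / 2 - 1)) *
      (ENNReal.ofReal (hdet S ^ (-((Module.finrank ℝ A : ℝ) / 2))) *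
        (colKernel (((n : ℝ) - m) * Module.finrank ℝ A / 2 - 1) S y r * t)) =
      (posDefCone (m + 1) A).indicator (fun T => ENNReal.ofReal (hdet T ^
        (((n : ℝ) - (m + 1 : ℕ) + 1) * Module.finrank ℝ A / 2 - 1)) * t) (asm S y r) := by
  by_cases hT : asm S y r ∈ posDefCone (m + 1) A
  · have ha := hdet_pos (h.imp_right fun _ => by omega) hS
    have hb := hdet_pos (h.imp_right fun _ => by omega) hT
    rw [Set.indicator_of_mem hT, colKernel, if_pos hT, ← mul_assoc, ← mul_assoc,
      ← ENNReal.ofReal_mul (by positivity), ← ENNReal.ofReal_mul (by positivity),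
      Real.div_rpow hb.le ha.le, ← Real.rpow_add ha, mul_div_assoc', mul_comm (hdet S ^ _),
      mul_div_assoc, ← Real.rpow_sub ha]
    have h0 : ((n : ℝ) - m + 1) * Module.finrank ℝ A / 2 - 1 + -((Module.finrank ℝ A : ℝ) / 2) -
        (((n : ℝ) - m) * Module.finrank ℝ A / 2 - 1) = 0 := by ring
    rw [h0, Real.rpow_zero, mul_one]
    congr 4
    push_cast
    ring
  · rw [Set.indicator_of_notMem hT, colKernel, if_neg hT]
    simp

end

variable {A : Type*} [NormedAddCommGroup A] [InnerProductSpace ℝ A]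
  [FiniteDimensional ℝ A] [MeasurableSpace A] [BorelSpace A]

theorem matVolume_zero (n : ℕ) : matVolume n 0 A Set.univ = 1 := by
  rw [matVolume]
  refine (Measure.pi_univ _).trans ?_
  simp

variable [RealNormedDivisionAlgebra A]

theorem hermVolume_zero : hermVolume 0 A Set.univ = 1 := by
  have : IsEmpty {p : Fin 0 × Fin 0 // p.2 < p.1} := ⟨fun p => p.1.1.elim0⟩
  rw [hermVolume, Measure.map_apply (measurable_hermOf 0) MeasurableSet.univ, Set.preimage_univ,
    Measure.prod_apply MeasurableSet.univ]
  simp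

/-- The property that the Gram matrix `X^* X` of a Lebesgue distributed `X` has the density
`C |S| ^ ((n - m + 1) β / 2 - 1)` on the cone of positive definite matrices. -/
def GramDensity (A : Type*) [NormedAddCommGroup A] [InnerProductSpace ℝ A]
    [FiniteDimensional ℝ A] [MeasurableSpace A] [BorelSpace A] [RealNormedDivisionAlgebra A]
    (n m : ℕ) (C : ℝ≥0∞) : Prop :=
  ∀ f : Matrix (Fin m) (Fin m) A → ℝ≥0∞, Measurable f →
    ∫⁻ X, f (adj X * X) ∂(matVolume n m A) = C * ∫⁻ S in posDefCone m A,
      ENNReal.ofReal (hdet S ^ (((n : ℝ) - m + 1) * Module.finrank ℝ A / 2 - 1)) * f S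
        ∂(hermVolume m A)

/-- Apply the density formula to the indicator of the complement of the cone. -/
theorem GramDensity.ae_mem {n m : ℕ} {C : ℝ≥0∞} (h : GramDensity A n m C) :
    ∀ᵐ X ∂(matVolume n m A), adj X * X ∈ posDefCone m A := by
  have hc := measurableSet_posDefCone (A := A) m
  have h0 := h ((posDefCone m A)ᶜ.indicator 1) (measurable_one.indicator hc.compl)
  rw [setLIntegral_congr_fun (g := fun _ => 0) hc (fun S hS => by
    simp [Set.indicator_of_notMem (Set.notMem_compl_iff.2 hS)]), lintegral_zero, mul_zero] at h0
  have hm : Measurable fun X : Matrix (Fin n) (Fin m) A =>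
      (posDefCone m A)ᶜ.indicator (1 : Matrix (Fin m) (Fin m) A → ℝ≥0∞) (adj X * X) :=
    (measurable_one.indicator hc.compl).comp measurable_gram
  rw [lintegral_eq_zero_iff hm] at h0
  filter_upwards [h0] with X hX
  by_contra hX'
  simp [Set.indicator_of_mem (Set.mem_compl hX')] at hX

theorem exists_gramDensity_succ {n m : ℕ} (h : (∀ x y z : A, x * y * z = x * (y * z)) ∨ m ≤ 1)
    (hmn : m < n) {C : ℝ≥0∞} (hC0 : C ≠ 0) (hC1 : C ≠ ∞) (hC : GramDensity A n m C) :
    ∃ C', C' ≠ 0 ∧ C' ≠ ∞ ∧ GramDensity A n (m + 1) C' := by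
  obtain ⟨c, hc0, hc1, hc⟩ := exists_lintegral_column A h hmn
  refine ⟨c * C, mul_ne_zero hc0 hC0, ENNReal.mul_ne_top hc1 hC1, fun f hf => ?_⟩
  have hcone := measurableSet_posDefCone (A := A) m
  have hcone' := measurableSet_posDefCone (A := A) (m + 1)
  set e := ((n : ℝ) - m) * Module.finrank ℝ A / 2 - 1 with he
  let Φ : Matrix (Fin m) (Fin m) A → ℝ≥0∞ := fun S =>
    ENNReal.ofReal (hdet S ^ (-((Module.finrank ℝ A : ℝ) / 2))) *
      ∫⁻ y : Fin m → A, ∫⁻ r : ℝ, colKernel e S y r * f (asm S y r)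
  have hΦ : Measurable Φ := by
    refine (measurable_hdet.pow_const _).ennreal_ofReal.mul ?_
    have h1 : Measurable fun p : (Matrix (Fin m) (Fin m) A × (Fin m → A)) × ℝ =>
        colKernel e p.1.1 p.1.2 p.2 * f (asm p.1.1 p.1.2 p.2) := by
      have h2 : Measurable fun p : (Matrix (Fin m) (Fin m) A × (Fin m → A)) × ℝ =>
          (p.1.1, p.1.2, p.2) :=
        measurable_fst.fst.prodMk (measurable_fst.snd.prodMk measurable_snd)
      exact ((measurable_colKernel e).comp h2).mul ((hf.comp measurable_asm).comp h2)
    exact h1.lintegral_prod_right'.lintegral_prod_right'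
  have hg : Measurable fun X : Matrix (Fin n) (Fin (m + 1)) A => f (adj X * X) :=
    hf.comp measurable_gram
  rw [lintegral_matVolume_succ hg]
  simp only [gram_appendCol]
  have hae : ∀ᵐ X ∂(matVolume n m A),
      ∫⁻ x : Fin n → A, f (asm (adj X * X) (actL (adj X) x) (dotR x x)) = c * Φ (adj X * X) := by
    filter_upwards [hC.ae_mem] with X hX
    exact hc X hX (fun p => f (asm (adj X * X) p.1 p.2))
      (hf.comp (continuous_asm continuous_const continuous_fst continuous_snd).measurable)
  -- After the column integral, the integrand depends on `X` only through `X^* X`, so the induction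
  -- hypothesis applies to `Φ`.
  rw [lintegral_congr_ae hae, lintegral_const_mul' _ _ hc1, hC Φ hΦ, mul_assoc,
    ← lintegral_indicator hcone, ← lintegral_indicator hcone', lintegral_hermVolume_succ]
  · congr 2
    refine lintegral_congr fun S => ?_
    by_cases hS : S ∈ posDefCone m A
    · rw [Set.indicator_of_mem hS]
      simp only [Φ]
      rw [← lintegral_const_mul' _ _ ENNReal.ofReal_ne_top,
        ← lintegral_const_mul' _ _ ENNReal.ofReal_ne_top]
      refine lintegral_congr fun y => ?_
      rw [← lintegral_const_mul' _ _ ENNReal.ofReal_ne_top,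
        ← lintegral_const_mul' _ _ ENNReal.ofReal_ne_top]
      refine lintegral_congr fun r => ?_
      rw [colKernel_mul_eq h hS]
      rfl
    · rw [Set.indicator_of_notMem hS]
      symm
      -- Outside the smaller cone both sides vanish, since the leading block of a positive definite
      -- matrix is positive definite.
      have : ∀ y r, asm S y r ∉ posDefCone (m + 1) A := fun y r hT =>
        hS (mem_posDefCone_of_asm _ _ _ hT)
      simp [Set.indicator_of_notMem (this _ _)]
  · exact ((measurable_hdet.pow_const _).ennreal_ofReal.mul hf).indicator hcone'

theorem exists_gramDensity {n m : ℕ} (h : (∀ x y z : A, x * y * z = x * (y * z)) ∨ m ≤ 2)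
    (hmn : m ≤ n) : ∃ C, C ≠ 0 ∧ C ≠ ∞ ∧ GramDensity A n m C := by
  induction m with
  | zero =>
    refine ⟨1, one_ne_zero, ENNReal.one_ne_top, fun f hf => ?_⟩
    have hsub : ∀ S : Matrix (Fin 0) (Fin 0) A, S = 0 := fun S => Subsingleton.elim _ _
    have h1 : ∀ X : Matrix (Fin n) (Fin 0) A, f (adj X * X) = f 0 := fun X => by rw [hsub (_ * _)]
    have h2 : ∀ S : Matrix (Fin 0) (Fin 0) A, f S = f 0 := fun S => by rw [hsub S]
    simp only [h1, hdet_zero_dim, posDefCone_zero, Measure.restrict_univ, Real.one_rpow,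
      ENNReal.ofReal_one, one_mul]
    rw [lintegral_const, lintegral_congr h2, lintegral_const, matVolume_zero, hermVolume_zero]
  | succ m ih =>
    obtain ⟨C, hC0, hC1, hC⟩ := ih (h.imp_right fun _ => by omega) (by omega)
    exact exists_gramDensity_succ (h.imp_right fun _ => by omega) (by omega) hC0 hC1 hC

end Gram

/-! ### Triangular matrices, their inverses, and Cholesky factors -/

section Triangular

variable {A : Type*} [NormedAddCommGroup A] [InnerProductSpace ℝ A] [RealNormedDivisionAlgebra A]

open RealNormedDivisionAlgebra

/-- Upper triangular matrices with positive real diagonal entries. -/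
def UpperPos {m : ℕ} (U : Matrix (Fin m) (Fin m) A) (r : Fin m → ℝ) : Prop :=
  (∀ i j, j < i → U i j = 0) ∧ ∀ i, 0 < r i ∧ U i i = r i • (1 : A)

theorem smul_one_mul (c : ℝ) (x : A) : (c • (1 : A)) * x = c • x := by
  rw [RealNormedDivisionAlgebra.smul_mul', one_mul']

theorem mul_smul_one (c : ℝ) (x : A) : x * (c • (1 : A)) = c • x := by
  rw [mul_smul', mul_one']

theorem UpperPos.mulVecR_apply_of_zero {m : ℕ} {U : Matrix (Fin m) (Fin m) A} {r : Fin m → ℝ}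
    (hU : UpperPos U r) {v : Fin m → A} {i : Fin m} (hv : ∀ k, i < k → v k = 0) :
    mulVecR U v i = r i • v i := by
  rw [mulVecR_apply, Finset.sum_eq_single i, (hU.2 i).2, smul_one_mul]
  · intro k _ hk
    rcases lt_or_gt_of_ne hk with h | h
    · rw [hU.1 i k h, zero_mul_alg]
    · rw [hv k h, mul_zero_alg]
  · simp

/-- Back substitution from the last coordinate upwards; no associativity enters, because each step
only divides by a real diagonal entry. -/
theorem UpperPos.eq_zero {m : ℕ} {U : Matrix (Fin m) (Fin m) A} {r : Fin m → ℝ}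
    (hU : UpperPos U r) {v : Fin m → A} {j : Fin m} (hv : ∀ k, j ≤ k → mulVecR U v k = 0) :
    ∀ i, j ≤ i → v i = 0 := by
  intro i
  induction i using WellFoundedGT.induction with
  | ind i ih =>
    intro hij
    have h := hU.mulVecR_apply_of_zero (v := v) (i := i) fun k hk => ih k hk (hij.trans hk.le)
    rw [hv i hij] at h
    exact (smul_eq_zero.1 h.symm).resolve_left (hU.2 i).1.ne'

theorem UpperPos.mulVecR_injective {m : ℕ} {U : Matrix (Fin m) (Fin m) A} {r : Fin m → ℝ}
    (hU : UpperPos U r) : Function.Injective (mulVecR U) := by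
  refine (injective_iff_map_eq_zero _).2 fun v hv => funext fun i => ?_
  exact hU.eq_zero (j := i) (fun k _ => congrFun hv k) i le_rfl

theorem mulVecR_col {m : ℕ} (U V : Matrix (Fin m) (Fin m) A) (j i : Fin m) :
    mulVecR U (fun k => V k j) i = (U * V) i j := by
  rw [mulVecR_apply, Matrix.mul_apply]

theorem UpperPos.right_inv_unique {m : ℕ} {U : Matrix (Fin m) (Fin m) A} {r : Fin m → ℝ}
    (hU : UpperPos U r) {V W : Matrix (Fin m) (Fin m) A} (h : U * V = U * W) : V = W := by
  ext i j
  refine congrFun (hU.mulVecR_injective (a₁ := fun k => V k j) (a₂ := fun k => W k j) ?_) i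
  funext i
  rw [mulVecR_col, mulVecR_col, h]

theorem UpperPos.right_inv {m : ℕ} {U : Matrix (Fin m) (Fin m) A} {r : Fin m → ℝ}
    (hU : UpperPos U r) {V : Matrix (Fin m) (Fin m) A} (h : U * V = 1) :
    UpperPos V fun i => (r i)⁻¹ := by
  have hupper : ∀ i j, j < i → V i j = 0 := fun i j hij =>
    hU.eq_zero (v := fun k => V k j) (j := i) (fun k hk => by
      rw [mulVecR_col, h, Matrix.one_apply_ne (hij.trans_le hk).ne']) i le_rfl
  refine ⟨hupper, fun i => ⟨inv_pos.2 (hU.2 i).1, ?_⟩⟩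
  have h1 := hU.mulVecR_apply_of_zero (v := fun k => V k i) (i := i) fun k hk => hupper k i hk
  rw [mulVecR_col, h, Matrix.one_apply_eq] at h1
  rw [h1, smul_smul, inv_mul_cancel₀ (hU.2 i).1.ne', one_smul]

theorem mulVecR_mul_of_assoc (h : ∀ x y z : A, x * y * z = x * (y * z)) {m : ℕ}
    (X Y : Matrix (Fin m) (Fin m) A) : mulVecR (X * Y) = mulVecR X ∘ₗ mulVecR Y := by
  refine LinearMap.ext fun v => funext fun i => ?_
  simp only [LinearMap.comp_apply, mulVecR_apply, Matrix.mul_apply, sum_mul_alg, mul_sum_alg, h]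
  exact Finset.sum_comm

theorem mul_assoc_of_assoc (h : ∀ x y z : A, x * y * z = x * (y * z)) {m : ℕ}
    (X Y Z : Matrix (Fin m) (Fin m) A) : X * Y * Z = X * (Y * Z) := by
  ext i j
  simp only [Matrix.mul_apply, sum_mul_alg, mul_sum_alg, h]
  exact Finset.sum_comm

theorem mulVecR_one {m : ℕ} : mulVecR (1 : Matrix (Fin m) (Fin m) A) = LinearMap.id := by
  refine LinearMap.ext fun v => funext fun i => ?_
  rw [mulVecR_apply, Finset.sum_eq_single i]
  · simp [one_mul']
  · intro j _ hj
    rw [Matrix.one_apply_ne hj.symm, zero_mul_alg]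
  · simp

theorem mul_one_matrix {m : ℕ} (X : Matrix (Fin m) (Fin m) A) : X * 1 = X := by
  ext i j
  rw [Matrix.mul_apply, Finset.sum_eq_single j]
  · simp [mul_one']
  · intro k _ hk
    rw [Matrix.one_apply_ne hk, mul_zero_alg]
  · simp

theorem one_mul_matrix {m : ℕ} (X : Matrix (Fin m) (Fin m) A) : 1 * X = X := by
  ext i j
  rw [← mulVecR_col, mulVecR_one]
  rfl

theorem adj_one {m : ℕ} : adj (1 : Matrix (Fin m) (Fin m) A) = 1 := by
  ext i j
  by_cases h : i = j
  · subst h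
    simp [adj_apply, conj_one]
  · simp [adj_apply, h, Ne.symm h, conj_zero]

theorem UpperPos.exists_inv [FiniteDimensional ℝ A] {m : ℕ}
    (h : (∀ x y z : A, x * y * z = x * (y * z)) ∨ m ≤ 2) {U : Matrix (Fin m) (Fin m) A}
    {r : Fin m → ℝ} (hU : UpperPos U r) : ∃ V, U * V = 1 ∧ V * U = 1 := by
  have hs := LinearMap.injective_iff_surjective.1 hU.mulVecR_injective
  choose v hv using fun j : Fin m => hs fun i => (1 : Matrix (Fin m) (Fin m) A) i j
  let V : Matrix (Fin m) (Fin m) A := Matrix.of fun i j => v j i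
  have hUV : U * V = 1 := by
    ext i j
    rw [← mulVecR_col]
    exact congrFun (hv j) i
  refine ⟨V, hUV, ?_⟩
  -- A right inverse comes from solving for each column. That it is also a left inverse follows from
  -- associativity, or else from direct computation in size at most two.
  rcases h with h | h
  · refine hU.right_inv_unique ?_
    rw [← mul_assoc_of_assoc h, hUV, one_mul_matrix, mul_one_matrix]
  · have hV := hU.right_inv hUV
    interval_cases m
    · exact Subsingleton.elim _ _
    · ext i j
      fin_cases i; fin_cases j
      have := (hU.2 0).1.ne'
      simp [Matrix.mul_apply, (hU.2 0).2, (hV.2 0).2, smul_one_mul, smul_smul, this]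
    · have h0 := (hU.2 0).1.ne'
      have h1 := (hU.2 1).1.ne'
      have hoff := congrFun (congrFun hUV 0) 1
      simp only [Matrix.mul_apply, Fin.sum_univ_two, (hU.2 0).2, (hV.2 1).2, smul_one_mul,
        mul_smul_one, ne_eq, zero_ne_one, not_false_eq_true, Matrix.one_apply_ne] at hoff
      -- Read off from the upper right entry of `U V = 1`, namely `r₀ V₀₁ + r₁⁻¹ U₀₁ = 0`.
      have hV01 : V 0 1 = -((r 0)⁻¹ * (r 1)⁻¹) • U 0 1 := by
        rw [eq_neg_of_add_eq_zero_right hoff |> fun _ => (inv_smul_smul₀ h0 (V 0 1)).symm,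
          eq_neg_of_add_eq_zero_left hoff]
        module
      ext i j
      fin_cases i <;> fin_cases j
      · simp [Matrix.mul_apply, Fin.sum_univ_two, (hU.2 0).2, (hV.2 0).2, hU.1 1 0 Fin.zero_lt_one,
          smul_one_mul, smul_smul, h0, mul_zero_alg]
      · simp only [Matrix.mul_apply, Fin.sum_univ_two, (hU.2 1).2, (hV.2 0).2, smul_one_mul,
          mul_smul_one, hV01, Fin.zero_eta, Fin.mk_one, ne_eq, zero_ne_one, not_false_eq_true,
          Matrix.one_apply_ne, smul_smul]
        rw [← add_smul]
        have : (r 0)⁻¹ + r 1 * -((r 0)⁻¹ * (r 1)⁻¹) = 0 := by field_simp; ring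
        rw [this, zero_smul]
      · simp [Matrix.mul_apply, Fin.sum_univ_two, hU.1 1 0 Fin.zero_lt_one,
          hV.1 1 0 Fin.zero_lt_one, zero_mul_alg, mul_zero_alg]
      · simp [Matrix.mul_apply, Fin.sum_univ_two, (hU.2 1).2, (hV.2 1).2,
          hV.1 1 0 Fin.zero_lt_one, smul_one_mul, smul_smul, h1, zero_mul_alg]

/-- The upper triangular matrix with leading block `U`, last column `u` and corner entry `d`. -/
def extendUpper {m : ℕ} (U : Matrix (Fin m) (Fin m) A) (u : Fin m → A) (d : ℝ) :
    Matrix (Fin (m + 1)) (Fin (m + 1)) A :=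
  Matrix.of fun i j =>
    Fin.lastCases (Fin.lastCases (d • (1 : A)) (fun _ => 0) j)
      (fun i => Fin.lastCases (u i) (fun j => U i j) j) i

theorem adj_extendUpper_mul {m : ℕ} (U : Matrix (Fin m) (Fin m) A) (u : Fin m → A) (d : ℝ) :
    adj (extendUpper U u d) * extendUpper U u d =
      asm (adj U * U) (actL (adj U) u) (dotR u u + d ^ 2) := by
  ext i j
  refine Fin.lastCases ?_ (fun i => ?_) i <;> refine Fin.lastCases ?_ (fun j => ?_) j
  · simp [Matrix.mul_apply, adj_apply, extendUpper, conj_mul_self, dotR, Finset.sum_smul, add_smul,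
      Fin.sum_univ_castSucc, norm_smul, norm_one_alg, sq]
  · simp [Matrix.mul_apply, adj_apply, extendUpper, actL_apply, conj_sum, conj_mul, conj_conj,
      Fin.sum_univ_castSucc, mul_zero_alg]
  · simp [Matrix.mul_apply, adj_apply, extendUpper, actL_apply, Fin.sum_univ_castSucc, conj_zero,
      zero_mul_alg]
  · simp [Matrix.mul_apply, adj_apply, extendUpper, Fin.sum_univ_castSucc, mul_zero_alg]

/-- Induction along borders: if the leading block is `U^* U` and the last column is `U^* U w`, the
factor gains the column `U w` and, in the corner, the square root of the Schur complement. -/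
theorem exists_isCholesky [FiniteDimensional ℝ A] {m : ℕ}
    (h : (∀ x y z : A, x * y * z = x * (y * z)) ∨ m ≤ 2) {S : Matrix (Fin m) (Fin m) A}
    (hS : S ∈ posDefCone m A) : ∃ U, IsCholesky U S := by
  induction m with
  | zero => exact ⟨0, fun i => i.elim0, fun i => i.elim0, Subsingleton.elim _ _⟩
  | succ m ih =>
    have h' : (∀ x y z : A, x * y * z = x * (y * z)) ∨ m ≤ 1 := h.imp_right fun _ => by omega
    obtain ⟨T, hT, w, r, hr, rfl⟩ := exists_eq_asm h' hS
    obtain ⟨U, hU1, hU2, rfl⟩ := ih (h.imp_right fun _ => by omega) hT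
    have hw : dotR (actL U w) (actL U w) = dotR (mulVecR (adj U * U) w) w := by
      rw [← actL_adj_actL h', dotR_actL_adj]
    refine ⟨extendUpper U (actL U w) (√(r - dotR (mulVecR (adj U * U) w) w)), ?_, ?_, ?_⟩
    · intro i j
      refine Fin.lastCases ?_ (fun i => ?_) i <;> refine Fin.lastCases ?_ (fun j => ?_) j
      · simp
      · simp [extendUpper]
      · intro hij
        exact absurd hij (Fin.castSucc_lt_last i).not_gt
      · intro hij
        simpa [extendUpper] using hU1 i j (Fin.castSucc_lt_castSucc_iff.1 hij)
    · intro i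
      refine Fin.lastCases ?_ (fun i => ?_) i
      · exact ⟨_, Real.sqrt_pos.2 (sub_pos.2 hr), by simp [extendUpper]⟩
      · simpa [extendUpper] using hU2 i
    · rw [adj_extendUpper_mul, actL_adj_actL h', hw, Real.sq_sqrt (sub_pos.2 hr).le,
        add_sub_cancel]

theorem IsCholesky.exists_upperPos {m : ℕ} {U S : Matrix (Fin m) (Fin m) A}
    (h : IsCholesky U S) : ∃ r, UpperPos U r := by
  choose r hr using h.2.1
  exact ⟨r, h.1, hr⟩

theorem mem_posDefCone_one {S : Matrix (Fin 1) (Fin 1) A} {p : ℝ} (hp : 0 < p)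
    (hS : S 0 0 = p • (1 : A)) : S ∈ posDefCone 1 A := by
  refine mem_posDefCone_iff.2 ⟨?_, fun v hv => ?_⟩
  · ext i j
    fin_cases i; fin_cases j
    simp [adj_apply, hS, conj_smul_one]
  · have h0 : v 0 ≠ 0 := fun h0 => hv (funext fun i => by rw [Subsingleton.elim i 0, h0]; rfl)
    have := norm_pos_iff.2 h0
    simp only [dotR, mulVecR_apply, Finset.univ_unique, Fin.default_eq_zero, Finset.sum_singleton,
      hS, smul_one_mul, real_inner_smul_right, real_inner_self_eq_norm_sq]
    positivity

end Triangular

/-! ### Determinants under triangular congruence -/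

section SmallDet

variable {A : Type*} [NormedAddCommGroup A] [InnerProductSpace ℝ A] [RealNormedDivisionAlgebra A]
  [FiniteDimensional ℝ A]

theorem hdet_one_dim {S : Matrix (Fin 1) (Fin 1) A} {p : ℝ} (hp : 0 < p)
    (hS : S 0 0 = p • (1 : A)) : hdet S = p := by
  have h0 : (0 : Matrix (Fin 0) (Fin 0) A) ∈ posDefCone 0 A := by simp [posDefCone_zero]
  have h := hdet_asm (Or.inr zero_le_one) h0 0 (r := p) (by simpa [dotR] using hp.le)
  have hS' : S = asm 0 (mulVecR 0 0) p := by
    ext i j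
    fin_cases i; fin_cases j
    exact hS.trans (asm_last_last (m := 0) 0 _ p).symm
  rw [hS', h, hdet_zero_dim]
  simp [dotR]

theorem hdet_two_dim {S : Matrix (Fin 2) (Fin 2) A} {p q : ℝ} (hp : 0 < p)
    (h00 : S 0 0 = p • (1 : A)) (h11 : S 1 1 = q • (1 : A)) (h10 : S 1 0 = conj (S 0 1))
    (hd : ‖S 0 1‖ ^ 2 ≤ p * q) : hdet S = p * q - ‖S 0 1‖ ^ 2 := by
  let T : Matrix (Fin 1) (Fin 1) A := Matrix.of fun _ _ => p • (1 : A)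
  have hT : T ∈ posDefCone 1 A := mem_posDefCone_one hp rfl
  let w : Fin 1 → A := fun _ => p⁻¹ • S 0 1
  have hTw : mulVecR T w = fun _ => S 0 1 := by
    funext i
    simp [mulVecR_apply, T, w, smul_one_mul, smul_smul, hp.ne']
  have hdot : dotR (mulVecR T w) w = p⁻¹ * ‖S 0 1‖ ^ 2 := by
    rw [hTw]
    simp [dotR, w, real_inner_smul_right]
  have hS : S = asm T (mulVecR T w) q := by
    rw [hTw]
    ext i j
    fin_cases i <;> fin_cases j
    · exact h00
    · rfl
    · exact h10
    · exact h11
  have h := hdet_asm (Or.inr le_rfl) hT w (r := q) (by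
    rw [hdot, inv_mul_le_iff₀ hp]; exact hd)
  rw [← hS, hdot, hdet_one_dim hp rfl] at h
  rw [h]
  field_simp

/-- With real diagonals and a triangular `V`, each product in `V^* B V` has at most two nonreal
factors, so the computation is valid over the octonions. -/
theorem hdet_conj_upper_two {B V : Matrix (Fin 2) (Fin 2) A} {r : Fin 2 → ℝ} (hV : UpperPos V r)
    (hB : B ∈ posDefCone 2 A) : hdet (adj V * B * V) = (r 0 * r 1) ^ 2 * hdet B := by
  obtain ⟨p, hp⟩ : ∃ p, p = re (B 0 0) := ⟨_, rfl⟩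
  obtain ⟨q, hq⟩ : ∃ q, q = re (B 1 1) := ⟨_, rfl⟩
  have h00 : B 0 0 = p • (1 : A) := by rw [hp]; exact diag_eq_of_adj hB.1 0
  have h11 : B 1 1 = q • (1 : A) := by rw [hq]; exact diag_eq_of_adj hB.1 1
  have h10 : B 1 0 = conj (B 0 1) := (congrFun (congrFun hB.1 1) 0).symm
  have hp0 : 0 < p := by
    have := (mem_posDefCone_iff.1 hB).2 (Pi.single 0 1) fun h => by
      have := congrFun h 0
      simp [RealNormedDivisionAlgebra.one_ne_zero'] at this
    simpa [dotR, mulVecR_apply, Fin.sum_univ_two, h00, smul_one_mul, real_inner_smul_right,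
      norm_one_alg, mul_zero_alg] using this
  have hpq : ‖B 0 1‖ ^ 2 ≤ p * q := by
    have := dotR_mulVecR_nonneg hB ![-(p⁻¹ • B 0 1), 1]
    simp [dotR, mulVecR_apply, Fin.sum_univ_two, h00, h11, h10, smul_one_mul, mul_neg_alg,
      RealNormedDivisionAlgebra.mul_smul', RealNormedDivisionAlgebra.mul_one', hp0.ne',
      conj_mul_self, real_inner_smul_right, norm_one_alg, inner_add_right] at this
    rw [inv_mul_le_iff₀ hp0] at this
    exact this
  have ha := (hV.2 0).1
  have hb := (hV.2 1).1
  have hV10 := hV.1 1 0 Fin.zero_lt_one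
  set x := V 0 1 with hx
  set y := B 0 1 with hy
  have w00 : (adj V * B * V) 0 0 = (r 0 ^ 2 * p) • (1 : A) := by
    simp [Matrix.mul_apply, Fin.sum_univ_two, adj_apply, (hV.2 0).2, hV10, h00, conj_smul_one,
      smul_one_mul, mul_smul_one, conj_zero, zero_mul_alg, mul_zero_alg, smul_smul]
    congr 1
    ring
  have w01 : (adj V * B * V) 0 1 = (r 0) • (p • x + r 1 • y) := by
    simp [Matrix.mul_apply, Fin.sum_univ_two, adj_apply, (hV.2 0).2, (hV.2 1).2, hV10, h00,
      conj_smul_one, smul_one_mul, mul_smul_one, conj_zero, zero_mul_alg,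
      smul_smul, ← hx, ← hy]
    module
  have w10 : (adj V * B * V) 1 0 = conj ((adj V * B * V) 0 1) := by
    rw [w01]
    simp [Matrix.mul_apply, Fin.sum_univ_two, adj_apply, (hV.2 0).2, (hV.2 1).2, hV10, h00, h10,
      mul_smul_one, mul_zero_alg, conj_add, conj_smul, conj_one,
      RealNormedDivisionAlgebra.smul_mul', RealNormedDivisionAlgebra.one_mul', smul_smul, ← hx, ← hy]
  have w11 : (adj V * B * V) 1 1 =
      (p * ‖x‖ ^ 2 + 2 * r 1 * inner ℝ y x + r 1 ^ 2 * q) • (1 : A) := by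
    have hsum : conj y * x + conj x * y = (2 * inner ℝ y x : ℝ) • (1 : A) := by
      rw [← re_conj_mul y x, ← add_conj, conj_mul, conj_conj]
    have : (adj V * B * V) 1 1 = (p * ‖x‖ ^ 2) • (1 : A) + r 1 • (conj y * x + conj x * y) +
        (r 1 ^ 2 * q) • (1 : A) := by
      simp only [Matrix.mul_apply, Fin.sum_univ_two, adj_apply, (hV.2 1).2, h00, h10, h11,
        conj_smul_one, mul_smul_one, RealNormedDivisionAlgebra.add_mul',
        RealNormedDivisionAlgebra.smul_mul', RealNormedDivisionAlgebra.one_mul', conj_mul_self,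
        ← hx, ← hy]
      module
    rw [this, hsum]
    module
  have hnorm : ‖(adj V * B * V) 0 1‖ ^ 2 =
      r 0 ^ 2 * (p ^ 2 * ‖x‖ ^ 2 + 2 * (p * r 1) * inner ℝ y x + r 1 ^ 2 * ‖y‖ ^ 2) := by
    rw [w01, norm_smul, mul_pow, norm_add_sq_real, norm_smul, norm_smul, real_inner_smul_left,
      real_inner_smul_right, real_inner_comm, mul_pow, mul_pow]
    simp only [Real.norm_eq_abs, sq_abs]
    ring
  have hdiff : r 0 ^ 2 * p * (p * ‖x‖ ^ 2 + 2 * r 1 * inner ℝ y x + r 1 ^ 2 * q) -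
      ‖(adj V * B * V) 0 1‖ ^ 2 = (r 0 * r 1) ^ 2 * (p * q - ‖y‖ ^ 2) := by
    rw [hnorm]; ring
  have hnn : 0 ≤ (r 0 * r 1) ^ 2 * (p * q - ‖y‖ ^ 2) :=
    mul_nonneg (sq_nonneg _) (sub_nonneg.2 hpq)
  rw [hdet_two_dim (by positivity) w00 w11 w10 (by linarith), hdiff,
    hdet_two_dim hp0 h00 h11 h10 hpq]

theorem hdet_gram_upper_two {U : Matrix (Fin 2) (Fin 2) A} {r : Fin 2 → ℝ} (hU : UpperPos U r) :
    hdet (adj U * U) = (r 0 * r 1) ^ 2 := by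
  have ha := (hU.2 0).1
  have hU10 := hU.1 1 0 Fin.zero_lt_one
  have w00 : (adj U * U) 0 0 = (r 0 ^ 2) • (1 : A) := by
    simp [Matrix.mul_apply, Fin.sum_univ_two, adj_apply, (hU.2 0).2, hU10, conj_smul_one,
      smul_one_mul, mul_zero_alg, smul_smul, sq]
  have w01 : (adj U * U) 0 1 = r 0 • U 0 1 := by
    simp [Matrix.mul_apply, Fin.sum_univ_two, adj_apply, (hU.2 0).2, hU10, conj_smul_one,
      smul_one_mul, conj_zero, zero_mul_alg]
  have w10 : (adj U * U) 1 0 = conj ((adj U * U) 0 1) := by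
    rw [w01]
    simp [Matrix.mul_apply, Fin.sum_univ_two, adj_apply, (hU.2 0).2, hU10, mul_smul_one,
      conj_smul, mul_zero_alg]
  have w11 : (adj U * U) 1 1 = (‖U 0 1‖ ^ 2 + r 1 ^ 2) • (1 : A) := by
    simp [Matrix.mul_apply, Fin.sum_univ_two, adj_apply, (hU.2 1).2, conj_mul_self,
      norm_smul, norm_one_alg, add_smul, sq]
  have hnorm : ‖(adj U * U) 0 1‖ ^ 2 = r 0 ^ 2 * ‖U 0 1‖ ^ 2 := by
    rw [w01, norm_smul, mul_pow, Real.norm_eq_abs, sq_abs]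
  have hdiff : r 0 ^ 2 * (‖U 0 1‖ ^ 2 + r 1 ^ 2) - ‖(adj U * U) 0 1‖ ^ 2 = (r 0 * r 1) ^ 2 := by
    rw [hnorm]; ring
  rw [hdet_two_dim (by positivity) w00 w11 w10 (by
    have := sq_nonneg (r 0 * r 1)
    linarith), hdiff]

/-- In the associative case the real determinant is multiplicative, and those of `U`, `V` and of
their adjoints cancel. In the other case `m ≤ 2` and explicit formulas are compared. -/
theorem hdet_conj_upper {m : ℕ} (h : (∀ x y z : A, x * y * z = x * (y * z)) ∨ m ≤ 2)
    {U V B : Matrix (Fin m) (Fin m) A} {r : Fin m → ℝ} (hU : UpperPos U r) (hUV : U * V = 1)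
    (hB : B ∈ posDefCone m A) (hS : adj U * U ∈ posDefCone m A) :
    hdet (adj V * B * V) * hdet (adj U * U) = hdet B := by
  have hV := hU.right_inv hUV
  rcases h with h | h
  · have h1 := congrArg (fun M => LinearMap.det (mulVecR M)) hUV
    have h2 := congrArg (fun M => LinearMap.det (mulVecR (adj M))) hUV
    simp only [adj_mul, adj_one, mulVecR_mul_of_assoc h, LinearMap.det_comp, mulVecR_one,
      LinearMap.det_id] at h1 h2
    have hSpos := det_mulVecR_pos (Or.inl h) hS
    have hBpos := det_mulVecR_pos (Or.inl h) hB
    have hprod : LinearMap.det (mulVecR (adj V * B * V)) * LinearMap.det (mulVecR (adj U * U)) =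
        LinearMap.det (mulVecR B) := by
      simp only [mulVecR_mul_of_assoc h, LinearMap.det_comp]
      calc _ = (LinearMap.det (mulVecR (adj V)) * LinearMap.det (mulVecR (adj U))) *
            (LinearMap.det (mulVecR U) * LinearMap.det (mulVecR V)) * LinearMap.det (mulVecR B) := by
            ring
        _ = _ := by rw [h1, h2, one_mul, one_mul]
    have hWpos : 0 < LinearMap.det (mulVecR (adj V * B * V)) :=
      pos_of_mul_pos_left (hprod ▸ hBpos) hSpos.le
    rw [hdet, hdet, hdet, ← Real.mul_rpow hWpos.le hSpos.le, hprod]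
  · interval_cases m
    · simp [hdet_zero_dim]
    · have hr := (hU.2 0).1
      obtain ⟨p, hp⟩ : ∃ p, p = re (B 0 0) := ⟨_, rfl⟩
      have h00 : B 0 0 = p • (1 : A) := by rw [hp]; exact diag_eq_of_adj hB.1 0
      have hp0 : 0 < p := by
        have := (mem_posDefCone_iff.1 hB).2 (fun _ => 1) fun h0 =>
          RealNormedDivisionAlgebra.one_ne_zero' (A := A) (congrFun h0 0)
        simpa [dotR, mulVecR_apply, h00, smul_one_mul, real_inner_smul_right,
          norm_one_alg] using this
      have e1 : (adj V * B * V) 0 0 = ((r 0)⁻¹ ^ 2 * p) • (1 : A) := by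
        simp [Matrix.mul_apply, adj_apply, (hV.2 0).2, h00, conj_smul_one, smul_one_mul, smul_smul]
        congr 1
        ring
      have e2 : (adj U * U) 0 0 = (r 0 ^ 2) • (1 : A) := by
        simp [Matrix.mul_apply, adj_apply, (hU.2 0).2, conj_smul_one, smul_one_mul, smul_smul, sq]
      rw [hdet_one_dim (by positivity) e1, hdet_one_dim (by positivity) e2, hdet_one_dim hp0 h00]
      field_simp
    · have h0 := (hU.2 0).1
      have h1 := (hU.2 1).1
      rw [hdet_conj_upper_two hV hB, hdet_gram_upper_two hU]
      field_simp

end SmallDet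

/-! ### Leading blocks and the highest weight vector -/

section Leading

theorem leading_apply {A : Type*} {m : ℕ} (S : Matrix (Fin m) (Fin m) A) (i : Fin m) (a b : Fin (i + 1)) :
    leading S i a b = S (Fin.castLE i.isLt a) (Fin.castLE i.isLt b) := rfl

variable {A : Type*} [NormedAddCommGroup A] [InnerProductSpace ℝ A] [RealNormedDivisionAlgebra A]

theorem sum_castLE {M : Type*} [AddCommMonoid M] {m : ℕ} (i : Fin m) (f : Fin m → M)
    (hf : ∀ k, i < k → f k = 0) :
    ∑ k, f k = ∑ k : Fin (i + 1), f (Fin.castLE i.isLt k) := by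
  refine (Fintype.sum_of_injective (Fin.castLE i.isLt) (Fin.castLE_injective _) _ _ ?_
    fun _ => rfl).symm
  intro k hk
  refine hf k (lt_of_not_ge fun hki => hk ⟨⟨k, Nat.lt_succ_of_le hki⟩, rfl⟩)

theorem castLE_le {m : ℕ} (i : Fin m) (a : Fin (i + 1)) : Fin.castLE i.isLt a ≤ i :=
  Nat.le_of_lt_succ a.2

theorem leading_mul_upper {m : ℕ} (X : Matrix (Fin m) (Fin m) A) {Y : Matrix (Fin m) (Fin m) A}
    (hY : ∀ i j, j < i → Y i j = 0) (i : Fin m) : leading (X * Y) i = leading X i * leading Y i := by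
  ext a b
  simp only [Matrix.mul_apply, leading_apply]
  exact sum_castLE i _ fun k hk => by rw [hY _ _ ((castLE_le i b).trans_lt hk), mul_zero_alg]

theorem leading_lower_mul {m : ℕ} {X : Matrix (Fin m) (Fin m) A} (Y : Matrix (Fin m) (Fin m) A)
    (hX : ∀ i j, i < j → X i j = 0) (i : Fin m) : leading (X * Y) i = leading X i * leading Y i := by
  ext a b
  simp only [Matrix.mul_apply, leading_apply]
  exact sum_castLE i _ fun k hk => by rw [hX _ _ ((castLE_le i a).trans_lt hk), zero_mul_alg]

theorem leading_adj {m : ℕ} (X : Matrix (Fin m) (Fin m) A) (i : Fin m) :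
    leading (adj X) i = adj (leading X i) := rfl

theorem leading_one {m : ℕ} (i : Fin m) : leading (1 : Matrix (Fin m) (Fin m) A) i = 1 :=
  Matrix.submatrix_one _ (Fin.castLE_injective _)

theorem UpperPos.leading {m : ℕ} {U : Matrix (Fin m) (Fin m) A} {r : Fin m → ℝ}
    (hU : UpperPos U r) (i : Fin m) :
    UpperPos (leading U i) fun a => r (Fin.castLE i.isLt a) :=
  ⟨fun _ _ hab => hU.1 _ _ hab, fun _ => hU.2 _⟩

theorem UpperPos.adj_lower {m : ℕ} {U : Matrix (Fin m) (Fin m) A} {r : Fin m → ℝ}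
    (hU : UpperPos U r) (i j : Fin m) (hij : i < j) : adj U i j = 0 := by
  rw [adj_apply, hU.1 j i hij, conj_zero]

theorem leading_mem_posDefCone {m : ℕ} {S : Matrix (Fin m) (Fin m) A} (hS : S ∈ posDefCone m A)
    (i : Fin m) : leading S i ∈ posDefCone (i + 1) A := by
  refine mem_posDefCone_iff.2 ⟨by rw [← leading_adj, hS.1], fun v hv => ?_⟩
  let v' : Fin m → A := fun k => if h : (k : ℕ) < i + 1 then v ⟨k, h⟩ else 0
  have hv' : ∀ a : Fin (i + 1), v' (Fin.castLE i.isLt a) = v a := fun a => dif_pos a.2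
  have hv0 : ∀ k, i < k → v' k = 0 := fun k hk => dif_neg (by
    have : (i : ℕ) < k := hk
    omega)
  have hne : v' ≠ 0 := fun h0 => hv (funext fun a => by rw [← hv', h0]; rfl)
  have h := (mem_posDefCone_iff.1 hS).2 v' hne
  rw [dotR, sum_castLE i _ fun k hk => by rw [hv0 k hk, inner_zero_left]] at h
  have hsum : ∀ k, mulVecR S v' k = ∑ b, S k (Fin.castLE i.isLt b) * v b := fun k => by
    rw [mulVecR_apply, sum_castLE i _ fun j hj => by rw [hv0 j hj, mul_zero_alg]]
    simp only [hv']
  simp only [hsum, hv'] at h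
  exact h

theorem chol_spec [FiniteDimensional ℝ A] {m : ℕ}
    (h : (∀ x y z : A, x * y * z = x * (y * z)) ∨ m ≤ 2) {S : Matrix (Fin m) (Fin m) A}
    (hS : S ∈ posDefCone m A) : IsCholesky (chol S) S := by
  have hex := exists_isCholesky h hS
  rw [chol, dif_pos hex]
  exact hex.choose_spec

theorem matInv_spec {m : ℕ} {S : Matrix (Fin m) (Fin m) A} (h : ∃ T, S * T = 1 ∧ T * S = 1) :
    S * matInv S = 1 ∧ matInv S * S = 1 := by
  rw [matInv, dif_pos h]
  exact h.choose_spec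

/-- Multiplying by lower triangular matrices on the left and upper triangular ones on the right
commutes with taking leading blocks. Each leading minor of the congruent matrix is therefore the
quotient of the minors of `B` and `S`. -/
theorem highestWeight_conj_chol [FiniteDimensional ℝ A] {m : ℕ}
    (h : (∀ x y z : A, x * y * z = x * (y * z)) ∨ m ≤ 2) (τ : Fin m → ℝ)
    {S B : Matrix (Fin m) (Fin m) A} (hS : S ∈ posDefCone m A) (hB : B ∈ posDefCone m A) :
    highestWeight τ (matInv (adj (chol S)) * B * matInv (chol S)) =
      highestWeight τ B / highestWeight τ S := by
  have hU := chol_spec h hS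
  set U := chol S
  obtain ⟨r, hr⟩ := hU.exists_upperPos
  obtain ⟨V₀, hV₀⟩ := hr.exists_inv h
  have hV := (matInv_spec ⟨V₀, hV₀⟩).1
  have hT := (matInv_spec (S := adj U) ⟨adj V₀, by rw [← adj_mul, hV₀.2, adj_one],
    by rw [← adj_mul, hV₀.1, adj_one]⟩).2
  set V := matInv U
  -- `matInv` is a choice, so the inverse of `U^*` must be identified with `V^*`; both adjoints
  -- solve `U W = 1`, whose solution is unique.
  have hTV : matInv (adj U) = adj V := by
    rw [← adj_adj (matInv (adj U))]
    congr 1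
    refine hr.right_inv_unique ?_
    rw [hV, ← adj_one, ← hT, adj_mul, adj_adj]
  have hVr := hr.right_inv hV
  rw [hTV, highestWeight, highestWeight, highestWeight, ← Finset.prod_div_distrib]
  refine Finset.prod_congr rfl fun i _ => ?_
  have hi : (∀ x y z : A, x * y * z = x * (y * z)) ∨ (i : ℕ) + 1 ≤ 2 :=
    h.imp_right fun h2 => by have := i.isLt; omega
  have hUV : leading U i * leading V i = 1 := by
    rw [← leading_mul_upper U hVr.1, hV, leading_one]
  have hSi := leading_mem_posDefCone hS i
  have hBi := leading_mem_posDefCone hB i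
  have hSU : leading S i = adj (leading U i) * leading U i := by
    conv_lhs => rw [hU.2.2]
    rw [leading_mul_upper _ hr.1, leading_adj]
  have hSi' := hSi
  rw [hSU] at hSi'
  have key := hdet_conj_upper hi (hr.leading i) hUV hBi hSi'
  rw [← hSU] at key
  have hSpos := hdet_pos hi hSi
  rw [leading_mul_upper _ hVr.1, leading_lower_mul _ hVr.adj_lower, leading_adj,
    eq_div_of_mul_eq hSpos.ne' key, Real.div_rpow (hdet_pos hi hBi).le hSpos.le]

end Leading

/-! ### The normalising constant from a Gaussian integral -/

section Constant

theorem lintegral_pi_prod_eq_pow {α : Type*} [MeasureSpace α] [SigmaFinite (volume : Measure α)]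
    (n : ℕ) {f : α → ℝ≥0∞} (hf : Measurable f) :
    ∫⁻ x : Fin n → α, ∏ i, f (x i) = (∫⁻ x, f x) ^ n := by
  induction n with
  | zero => simp [volume_pi]
  | succ n ih =>
    have hmp := (volume_preserving_piFinSuccAbove (fun _ : Fin (n + 1) => α) 0).symm
    have hm : ∀ k, Measurable fun x : Fin k → α => ∏ i, f (x i) := fun k =>
      Finset.measurable_prod _ fun i _ => hf.comp (measurable_pi_apply i)
    rw [← hmp.lintegral_comp (hm (n + 1)), pow_succ', ← ih,
      ← lintegral_prod_mul hf.aemeasurable (hm n).aemeasurable]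
    refine lintegral_congr fun p => ?_
    rw [Fin.prod_univ_succ]
    simp [MeasurableEquiv.piFinSuccAbove]

variable {A : Type*} [NormedAddCommGroup A] [InnerProductSpace ℝ A] [RealNormedDivisionAlgebra A]

theorem reTr_gram {n m : ℕ} (X : Matrix (Fin n) (Fin m) A) :
    reTr (adj X * X) = ∑ i, ∑ j, ‖X i j‖ ^ 2 := by
  simp only [reTr, re_sum, Matrix.mul_apply, adj_apply, re_conj_mul, real_inner_self_eq_norm_sq]
  exact Finset.sum_comm

theorem highestWeight_zero {m : ℕ} (S : Matrix (Fin m) (Fin m) A) : highestWeight 0 S = 1 := by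
  simp [highestWeight]

variable [FiniteDimensional ℝ A] [MeasurableSpace A] [BorelSpace A]

theorem lintegral_exp_neg_reTr_gram (n m : ℕ) :
    ∫⁻ X, ENNReal.ofReal (Real.exp (-reTr (adj X * X))) ∂(matVolume n m A) =
      ENNReal.ofReal (Real.pi ^ ((Module.finrank ℝ A : ℝ) * m * n / 2)) := by
  have h0 : ∫⁻ x : A, ENNReal.ofReal (Real.exp (-‖x‖ ^ 2)) =
      ENNReal.ofReal (Real.pi ^ ((Module.finrank ℝ A : ℝ) / 2)) := by
    have h1 := GaussianFourier.integral_rexp_neg_mul_sq_norm (V := A) one_pos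
    simp only [div_one, neg_mul, one_mul] at h1
    rw [← ofReal_integral_eq_lintegral_ofReal, h1]
    · by_contra hni
      rw [integral_undef hni] at h1
      exact (Real.rpow_pos_of_pos Real.pi_pos _).ne h1
    · exact Filter.Eventually.of_forall fun _ => (Real.exp_pos _).le
  have h2 : ∀ X : Matrix (Fin n) (Fin m) A, ENNReal.ofReal (Real.exp (-reTr (adj X * X))) =
      ∏ i, ∏ j, ENNReal.ofReal (Real.exp (-‖X i j‖ ^ 2)) := fun X => by
    rw [reTr_gram, ← Finset.sum_neg_distrib, Real.exp_sum,
      ENNReal.ofReal_prod_of_nonneg fun _ _ => (Real.exp_pos _).le]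
    refine Finset.prod_congr rfl fun i _ => ?_
    rw [← Finset.sum_neg_distrib, Real.exp_sum,
      ENNReal.ofReal_prod_of_nonneg fun _ _ => (Real.exp_pos _).le]
  have hm : Measurable fun x : A => ENNReal.ofReal (Real.exp (-‖x‖ ^ 2)) := by fun_prop
  simp only [h2]
  refine (lintegral_pi_prod_eq_pow n (f := fun x : Fin m → A =>
    ∏ j, ENNReal.ofReal (Real.exp (-‖x j‖ ^ 2)))
    (Finset.measurable_prod _ fun j _ => hm.comp (measurable_pi_apply j))).trans ?_
  rw [lintegral_pi_prod_eq_pow m hm, h0, ← pow_mul, ← ENNReal.ofReal_pow (by positivity),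
    ← Real.rpow_natCast, ← Real.rpow_mul Real.pi_pos.le]
  congr 2
  push_cast
  ring

/-- Test the density formula on `exp (-tr S)`. On matrices this is a product of Gaussians, since `tr
X^* X` is the sum of the squared norms of the entries; on the cone it gives the multivariate gamma
integral. -/
theorem GramDensity.mul_mvGamma {n m : ℕ} {C : ℝ≥0∞}
    (h : (∀ x y z : A, x * y * z = x * (y * z)) ∨ m ≤ 2) (hC0 : C ≠ 0) (hC : GramDensity A n m C) :
    C * ENNReal.ofReal (mvGamma m A (n * Module.finrank ℝ A / 2)) =
      ENNReal.ofReal (Real.pi ^ ((Module.finrank ℝ A : ℝ) * m * n / 2)) := by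
  have hm : Measurable fun S : Matrix (Fin m) (Fin m) A =>
      ENNReal.ofReal (Real.exp (-reTr S)) :=
    (Real.measurable_exp.comp continuous_reTr.measurable.neg).ennreal_ofReal
  have h1 := hC _ hm
  rw [lintegral_exp_neg_reTr_gram] at h1
  have hcone := measurableSet_posDefCone (A := A) m
  let F : Matrix (Fin m) (Fin m) A → ℝ := fun S => Real.exp (-reTr S) *
    hdet S ^ ((n : ℝ) * Module.finrank ℝ A / 2 - ((m : ℝ) - 1) * (Module.finrank ℝ A : ℝ) / 2 - 1) *
      highestWeight 0 S
  have hFm : Measurable F :=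
    ((Real.measurable_exp.comp continuous_reTr.measurable.neg).mul
      (measurable_hdet.pow_const _)).mul (measurable_highestWeight 0)
  have hF : ∀ S ∈ posDefCone m A, ENNReal.ofReal (hdet S ^ (((n : ℝ) - m + 1) *
      Module.finrank ℝ A / 2 - 1)) * ENNReal.ofReal (Real.exp (-reTr S)) =
      ENNReal.ofReal (F S) := fun S hS => by
    have := hdet_pos h hS
    rw [← ENNReal.ofReal_mul (by positivity), mul_comm]
    simp only [F, highestWeight_zero, mul_one]
    congr 3
    ring
  have hFnn : 0 ≤ᵐ[(hermVolume m A).restrict (posDefCone m A)] F := by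
    filter_upwards [ae_restrict_mem hcone] with S hS
    have := hdet_pos h hS
    simp only [F, highestWeight_zero, mul_one, Pi.zero_apply]
    positivity
  rw [setLIntegral_congr_fun hcone hF] at h1
  -- Convergence of the gamma integral is deduced from finiteness of the Gaussian one and `C ≠ 0`;
  -- without it the Bochner integral would take its default value `0`.
  have hfin : ∫⁻ S in posDefCone m A, ENNReal.ofReal (F S) ∂(hermVolume m A) ≠ ∞ := fun ht => by
    rw [ht, ENNReal.mul_top hC0] at h1
    exact ENNReal.ofReal_ne_top h1
  have hG : mvGamma m A (n * Module.finrank ℝ A / 2) =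
      ∫ S in posDefCone m A, F S ∂(hermVolume m A) := rfl
  rw [h1, hG, integral_eq_lintegral_of_nonneg_ae hFnn hFm.aestronglyMeasurable,
    ENNReal.ofReal_toReal hfin]

end Constant

/-! ### Pushing the Pearson law forward -/

section Main

variable {A : Type*} [NormedAddCommGroup A] [InnerProductSpace ℝ A] [RealNormedDivisionAlgebra A]
  [FiniteDimensional ℝ A] [MeasurableSpace A] [BorelSpace A]

theorem measurable_betaRieszDensity (n : ℕ) {m : ℕ} (ν k : ℝ) (τ : Fin m → ℝ) (ρ : ℝ)
    (Sg : Matrix (Fin m) (Fin m) A) : Measurable (betaRieszDensity n ν k τ ρ Sg) := by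
  have hlin : Measurable fun B : Matrix (Fin m) (Fin m) A => 1 - ρ * reTr (matInv Sg * B) :=
    (continuous_const.sub (continuous_const.mul
      (continuous_reTr.comp (continuous_matMul continuous_const continuous_id)))).measurable
  unfold betaRieszDensity
  refine Measurable.ite ((measurableSet_posDefCone m).inter
    (measurableSet_lt measurable_const hlin)) ?_ measurable_const
  exact ((measurable_const.mul (measurable_hdet.pow_const _)).mul (hlin.pow_const _)).mul
    (measurable_highestWeight τ)

/-- This exhibits the Pearson density as a function of the Gram matrix, divided by the Gram density
so that the change of variables restores that factor. -/
theorem pearsonDensity_eq {n m : ℕ} (h : (∀ x y z : A, x * y * z = x * (y * z)) ∨ m ≤ 2)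
    (ν k : ℝ) (τ : Fin m → ℝ) (ρ : ℝ) {Sg : Matrix (Fin m) (Fin m) A} (hSg : Sg ∈ posDefCone m A)
    {X : Matrix (Fin n) (Fin m) A} (hX : adj X * X ∈ posDefCone m A) :
    pearsonDensity ν k τ ρ Sg X =
      mvGamma m A (n * Module.finrank ℝ A / 2) /
        Real.pi ^ ((Module.finrank ℝ A : ℝ) * m * n / 2) *
        (betaRieszDensity n ν k τ ρ Sg (adj X * X) /
          hdet (adj X * X) ^ (((n : ℝ) - m + 1) * Module.finrank ℝ A / 2 - 1)) := by
  have hpos : 0 < hdet (adj X * X) ^ (((n : ℝ) - m + 1) * Module.finrank ℝ A / 2 - 1) :=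
    Real.rpow_pos_of_pos (hdet_pos h hX) _
  have hpi : 0 < Real.pi ^ ((Module.finrank ℝ A : ℝ) * m * n / 2) :=
    Real.rpow_pos_of_pos Real.pi_pos _
  unfold pearsonDensity betaRieszDensity
  by_cases hd : 0 < 1 - ρ * reTr (matInv Sg * (adj X * X))
  · rw [if_pos hd, if_pos ⟨hX, hd⟩, highestWeight_conj_chol h τ hSg hX]
    have e1 : (m : ℝ) * n * Module.finrank ℝ A / 2 = (Module.finrank ℝ A : ℝ) * m * n / 2 := by ring
    have e2 : (Module.finrank ℝ A : ℝ) * n / 2 = n * Module.finrank ℝ A / 2 := by ring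
    simp only [e1, e2]
    generalize hdet (adj X * X) ^ (((n : ℝ) - m + 1) * Module.finrank ℝ A / 2 - 1) = a at *
    generalize Real.pi ^ ((Module.finrank ℝ A : ℝ) * m * n / 2) = b at *
    have hcancel : ∀ K l q : ℝ, K * a * l * q / a = K * l * q := fun K l q => by
      field_simp
    rw [hcancel]
    ring
  · rw [if_neg hd, if_neg fun h => hd h.2]
    simp

theorem map_gram_pearsonLaw {n m : ℕ} (h : (∀ x y z : A, x * y * z = x * (y * z)) ∨ m ≤ 2)
    (hnm : m ≤ n) (ν k : ℝ) (τ : Fin m → ℝ) (ρ : ℝ) {Sg : Matrix (Fin m) (Fin m) A}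
    (hSg : Sg ∈ posDefCone m A) :
    (pearsonLaw n ν k τ ρ Sg).map (fun X => adj X * X) = betaRieszLaw n ν k τ ρ Sg := by
  obtain ⟨C, hC0, hC1, hC⟩ := exists_gramDensity (A := A) h hnm
  have hgamma := hC.mul_mvGamma h hC0
  set c := mvGamma m A (n * Module.finrank ℝ A / 2) /
    Real.pi ^ ((Module.finrank ℝ A : ℝ) * m * n / 2)
  have hcone := measurableSet_posDefCone (A := A) m
  have hβ := measurable_betaRieszDensity n ν k τ ρ Sg
  have hpi : 0 < Real.pi ^ ((Module.finrank ℝ A : ℝ) * m * n / 2) :=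
    Real.rpow_pos_of_pos Real.pi_pos _
  -- The Gaussian normalisation says precisely that the constant `c` left in the Pearson density
  -- inverts `C`.
  have hc : C * ENNReal.ofReal c = 1 := by
    rw [ENNReal.ofReal_div_of_pos hpi, ← mul_div_assoc, hgamma]
    exact ENNReal.div_self (by simpa using hpi) ENNReal.ofReal_ne_top
  -- A negative `c` would be truncated to `0` by `ENNReal.ofReal`, contradicting `hc`.
  have hc0 : 0 ≤ c := by
    by_contra hneg
    rw [ENNReal.ofReal_of_nonpos (not_le.1 hneg).le, mul_zero] at hc
    exact zero_ne_one hc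
  ext s hs
  have hw : Measurable fun B : Matrix (Fin m) (Fin m) A => s.indicator (fun B => ENNReal.ofReal
      (c * (betaRieszDensity n ν k τ ρ Sg B /
        hdet B ^ (((n : ℝ) - m + 1) * Module.finrank ℝ A / 2 - 1)))) B :=
    ((hβ.div (measurable_hdet.pow_const _)).const_mul c).ennreal_ofReal.indicator hs
  rw [Measure.map_apply measurable_gram hs, pearsonLaw,
    withDensity_apply _ (measurable_gram hs), betaRieszLaw, withDensity_apply _ hs,
    ← lintegral_indicator (measurable_gram hs)]
  have hae : ∀ᵐ X ∂(matVolume n m A),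
      ((fun X : Matrix (Fin n) (Fin m) A => adj X * X) ⁻¹' s).indicator
        (fun X => ENNReal.ofReal (pearsonDensity ν k τ ρ Sg X)) X =
      s.indicator (fun B => ENNReal.ofReal (c * (betaRieszDensity n ν k τ ρ Sg B /
        hdet B ^ (((n : ℝ) - m + 1) * Module.finrank ℝ A / 2 - 1)))) (adj X * X) := by
    filter_upwards [hC.ae_mem] with X hX
    by_cases hXs : adj X * X ∈ s
    · rw [Set.indicator_of_mem hXs,
        Set.indicator_of_mem (s := (fun X : Matrix (Fin n) (Fin m) A => adj X * X) ⁻¹' s) hXs,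
        pearsonDensity_eq h ν k τ ρ hSg hX]
    · rw [Set.indicator_of_notMem hXs, Set.indicator_of_notMem (by simpa using hXs)]
  rw [lintegral_congr_ae hae, hC _ hw, ← lintegral_const_mul' _ _ hC1,
    ← lintegral_indicator hcone, ← lintegral_indicator hs]
  refine lintegral_congr fun B => ?_
  by_cases hB : B ∈ posDefCone m A
  · by_cases hBs : B ∈ s
    · have ha : 0 < hdet B ^ (((n : ℝ) - m + 1) * Module.finrank ℝ A / 2 - 1) :=
        Real.rpow_pos_of_pos (hdet_pos h hB) _
      rw [Set.indicator_of_mem hB, Set.indicator_of_mem hBs, Set.indicator_of_mem hBs,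
        ← ENNReal.ofReal_mul ha.le, mul_left_comm, mul_div_cancel₀ _ ha.ne',
        ENNReal.ofReal_mul hc0, ← mul_assoc, hc, one_mul]
    · rw [Set.indicator_of_mem hB, Set.indicator_of_notMem hBs, Set.indicator_of_notMem hBs,
        mul_zero, mul_zero]
  · rw [Set.indicator_of_notMem hB]
    by_cases hBs : B ∈ s
    · rw [Set.indicator_of_mem hBs, betaRieszDensity, if_neg fun h => hB h.1, ENNReal.ofReal_zero]
    · rw [Set.indicator_of_notMem hBs]

end Main

end PearsonRiesz

open PearsonRiesz
theorem mainTheorem3 {A : Type*} [NormedAddCommGroup A] [InnerProductSpace ℝ A]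
    [RealNormedDivisionAlgebra A] [FiniteDimensional ℝ A] [MeasurableSpace A] [BorelSpace A]
    (n m : ℕ) (hm : 1 ≤ m) (hnm : m ≤ n)
    (hA : (∀ x y z : A, x * y * z = x * (y * z)) ∨ m ≤ 2)
    (ν k ρ : ℝ) (τ : Fin m → ℝ) (Sg : Matrix (Fin m) (Fin m) A)
    (hρ : 0 < ρ)
    (hν : 0 < ν * (Module.finrank ℝ A : ℝ) / 2 + k)
    (hτ : ∀ i : Fin m,
      (i : ℝ) * (Module.finrank ℝ A : ℝ) / 2 - τ i < n * (Module.finrank ℝ A : ℝ) / 2)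
    (hSg : Sg ∈ posDefCone m A)
    {Ω : Type*} [MeasurableSpace Ω] (P : Measure Ω)
    (R : Ω → Matrix (Fin n) (Fin m) A)
    (hR : HasLaw R (pearsonLaw n ν k τ ρ Sg) P) :
    HasLaw (fun ω => adj (R ω) * R ω) (betaRieszLaw n ν k τ ρ Sg) P where
  aemeasurable := measurable_gram.comp_aemeasurable hR.aemeasurable
  map_eq := by
    rw [← map_gram_pearsonLaw hA hnm ν k τ ρ hSg, ← hR.map_eq,
      AEMeasurable.map_map_of_aemeasurable measurable_gram.aemeasurable hR.aemeasurable]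
    rfl
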